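/- Let $p_1=(0,0)$, $p_2=(\tfrac12,\tfrac{\sqrt3}2)$, $p_3=(1,0)$, $V_0=\{p_1,p_2,p_3\}$ and $f_j(x)=\tfrac12(x-p_j)+p_j$ on $\mathbb R^2$. For a word $w=w_1\cdots w_n\in\{1,2,3\}^n$ let $f_w=f_{w_n}\circ\cdots\circ f_{w_1}$. Let $T$ be the union of the three sides of the triangle with vertices $p_1,p_2,p_3$, and let $SG=\overline{\bigcup_{n\ge0}\bigcup_{|w|=n}f_w(T)}$ be the Sierpinski gasket. For $j=1,2,3$ let $h_j:SG\to\mathbb R$ be the harmonic function with $h_j(p_k)=\delta_{jk}$, that is, the continuous function with these values on $V_0$ which, for every $n$, minimizes the energy $E_n(f)=\sum_{x\sim_n y}(f(x)-f(y))^2$ among all functions with these values on $V_0$; here $x\sim_n y$ means that $x\neq y$ both lie in $f_w(V_0)$ for some word $w$ of length $n$, and each pair is counted once. Put $\Phi(x)=\tfrac1{\sqrt2}\bigl((h_1(x),h_2(x),h_3(x))-\tfrac13(1,1,1)\bigr)$ for $x\in SG$, and let $K_H=\Phi(SG)\subset\mathbb R^3$ be the harmonic Sierpinski gasket. Let $R_1,R_2,\dots$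 be an enumeration of the edges of all levels (the three sides of $f_w(T)$, for all words $w$ of all lengths $n\ge0$), let $\Phi(R_j)$ be the corresponding curves in $K_H$, and let $\ell_j$ be the (Euclidean) length of $\Phi(R_j)$. For $\ell>0$ let $D_\ell$ be the operator on $L^2([-\ell,\ell],\tfrac{1}{2\ell}dx)$ which is the sum of $\tfrac{\pi}{2\ell}I$ and the closure of $-i\frac{d}{dx}$ restricted to the linear span of the functions $e^{i\pi kx/\ell}$, $k\in\mathbb Z$. Let $D_{K_H}=\bigoplus_{j\ge1}D_{\ell_j}$ be the operator of the direct sum spectral triple of $K_H$, and let $$d_{s,H}=\inf\{p>0:\ \mathrm{tr}\bigl((I+D_{K_H}^2)^{-p/2}\bigr)<\infty\}$$ be the spectral dimension of $K_H$. Then $\sum_{j\ge1}\ell_j^s<\infty$ for every real $s>\dfrac{\log 3}{\log 5-\log 3}$, and $$1\le d_{s,H}\le\frac{\log 3}{\log 5-\log 3}.$$ -/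

import Mathlib

namespace HarmonicGasket

open MeasureTheory

noncomputable section

/-! ### The classical Sierpinski gasket -/

/-- The corners `(0,0)`, `(1/2, √3/2)`, `(1,0)` of the initial equilateral triangle. -/
def corner : Fin 3 → EuclideanSpace ℝ (Fin 2) :=
  ![!₂[0, 0], !₂[1 / 2, Real.sqrt 3 / 2], !₂[1, 0]]

/-- The contraction `x ↦ (x - p_j) / 2 + p_j`. -/
def contr (j : Fin 3) (x : EuclideanSpace ℝ (Fin 2)) : EuclideanSpace ℝ (Fin 2) :=
  (1 / 2 : ℝ) • (x - corner j) + corner j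

/-- For a word `w = w₁ w₂ … wₙ`, the map `f_w = f_{wₙ} ∘ ⋯ ∘ f_{w₂} ∘ f_{w₁}`. -/
def contrWord (w : List (Fin 3)) (x : EuclideanSpace ℝ (Fin 2)) : EuclideanSpace ℝ (Fin 2) :=
  w.foldl (fun y j => contr j y) x

/-- The initial graph: the union of the three sides of the triangle. The sides are the segments
from `p_i` to `p_{i+1}`, with `i + 1` taken modulo 3. -/
def triangle : Set (EuclideanSpace ℝ (Fin 2)) :=
  ⋃ i : Fin 3, segment ℝ (corner i) (corner (i + 1))

/-- The `n`-th graph approximation of the gasket. -/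
def gasketGraph (n : ℕ) : Set (EuclideanSpace ℝ (Fin 2)) :=
  ⋃ w ∈ {w : List (Fin 3) | w.length = n}, contrWord w '' triangle

/-- The Sierpinski gasket `SG`. -/
def gasket : Set (EuclideanSpace ℝ (Fin 2)) :=
  closure (⋃ n : ℕ, gasketGraph n)

/-! ### Harmonic functions and the harmonic gasket -/

/-- The energy `∑ (f x - f y)²` on level `n`, the sum being over the pairs `x ∼ₙ y`, each counted
once: these are the pairs `f_w p_i`, `f_w p_{i+1}` with `w` a word of length `n` and `i` in
`Fin 3`, and different `(w, i)` give different pairs. Only the values of `f` at the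
vertices of level `n` matter. -/
def energy (n : ℕ) (f : EuclideanSpace ℝ (Fin 2) → ℝ) : ℝ :=
  ∑ w : Fin n → Fin 3, ∑ i : Fin 3,
    (f (contrWord (List.ofFn w) (corner i)) - f (contrWord (List.ofFn w) (corner (i + 1)))) ^ 2

/-- `f` is (on the gasket) the function `h_j`: it is continuous on the gasket, has the value
`1` at `p_j` and `0` at the two other corners, and minimizes each energy among all functions with
these values at the corners. There is exactly one such function on the gasket. -/
structure IsHarmonicCoord (j : Fin 3) (f : EuclideanSpace ℝ (Fin 2) → ℝ) : Prop where
  boundary : ∀ k : Fin 3, f (corner k) = if k = j then 1 else 0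
  minimizes : ∀ (n : ℕ) (g : EuclideanSpace ℝ (Fin 2) → ℝ),
    (∀ k : Fin 3, g (corner k) = f (corner k)) → energy n f ≤ energy n g
  continuousOn : ContinuousOn f gasket

/-- The harmonic function `h_j`. Its values off the gasket are irrelevant. -/
def harmonicCoord (j : Fin 3) : EuclideanSpace ℝ (Fin 2) → ℝ :=
  Classical.epsilon (IsHarmonicCoord j)

/-- The map `Φ(x) = (1/√2) ((h₁(x), h₂(x), h₃(x)) - (1/3) (1, 1, 1))`, to be used on the gasket;
the harmonic Sierpinski gasket is the image of the gasket. -/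
def harmonicMap (x : EuclideanSpace ℝ (Fin 2)) : EuclideanSpace ℝ (Fin 3) :=
  WithLp.toLp 2 fun j => 1 / Real.sqrt 2 * (harmonicCoord j x - 1 / 3)

/-- The harmonic Sierpinski gasket `K_H`. -/
def harmonicGasket : Set (EuclideanSpace ℝ (Fin 3)) :=
  harmonicMap '' gasket

/-! ### The edge curves and their lengths -/

/-- The index set of the edges of all the graph approximations: `(w, i)` stands for the edge of
level `w.length` that joins `f_w p_i` to `f_w p_{i+1}`. There are `3 ^ (n + 1)` of level `n`. -/
abbrev Edge : Type := List (Fin 3) × Fin 3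

/-- The arc length parametrization, on `[0, 2⁻ⁿ]`, of an edge of level `n`. -/
def edgeCurve (e : Edge) (t : ℝ) : EuclideanSpace ℝ (Fin 2) :=
  AffineMap.lineMap (contrWord e.1 (corner e.2)) (contrWord e.1 (corner (e.2 + 1)))
    ((2 : ℝ) ^ e.1.length * t)

/-- The length (supremum of the lengths of inscribed polygons) of the image under `Φ` of an edge. -/
def edgeLength (e : Edge) : ENNReal :=
  eVariationOn (fun t => harmonicMap (edgeCurve e t)) (Set.Icc 0 ((2 : ℝ) ^ e.1.length)⁻¹)

/-! ### The operator of the spectral triple of a curve of length `ℓ` -/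

/-- Normalized Lebesgue measure on `[-ℓ, ℓ]`. -/
def curveMeasure (ℓ : ℝ) : Measure ℝ :=
  (ENNReal.ofReal (2 * ℓ))⁻¹ • (volume.restrict (Set.Icc (-ℓ) ℓ))

/-- The Hilbert space `L²([-ℓ, ℓ], (2ℓ)⁻¹ m)`. -/
abbrev CurveSpace (ℓ : ℝ) : Type := Lp ℂ 2 (curveMeasure ℓ)

/-- The exponential `x ↦ exp (i π k x / ℓ)`. -/
def expFun (ℓ : ℝ) (k : ℤ) (x : ℝ) : ℂ :=
  Complex.exp (Complex.I * Real.pi * k * x / ℓ)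

/-- The linear span of the exponentials, as functions. -/
def expSpan (ℓ : ℝ) : Submodule ℂ (ℝ → ℂ) :=
  Submodule.span ℂ (Set.range (expFun ℓ))

theorem differentiable_of_mem_expSpan {ℓ : ℝ} {g : ℝ → ℂ} (hg : g ∈ expSpan ℓ) :
    Differentiable ℝ g := by
  induction hg using Submodule.span_induction with
  | mem x hx =>
    obtain ⟨k, rfl⟩ := hx
    intro x
    have h : DifferentiableAt ℝ (fun y : ℝ => (y : ℂ)) x :=
      Complex.ofRealCLM.differentiableAt
    unfold expFun
    simp only [div_eq_mul_inv]
    exact ((h.const_mul _).mul_const _).cexp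
  | zero => exact differentiable_const 0
  | add x y _ _ hx hy => exact hx.add hy
  | smul a x _ hx => exact hx.const_smul a

/-- The graph of `-i d/dx` on the linear span of the exponentials: the pairs of (classes of)
functions `(g, -i g')`, for `g` in that span. -/
def derivGraph (ℓ : ℝ) : Submodule ℂ (CurveSpace ℓ × CurveSpace ℓ) where
  carrier := {z | ∃ g ∈ expSpan ℓ, z.1 =ᵐ[curveMeasure ℓ] g ∧
    z.2 =ᵐ[curveMeasure ℓ] fun x => -Complex.I * deriv g x}
  zero_mem' := by
    refine ⟨0, Submodule.zero_mem _, Lp.coeFn_zero _ _ _, ?_⟩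
    filter_upwards [Lp.coeFn_zero ℂ 2 (curveMeasure ℓ)] with x hx
    simpa [Pi.zero_def] using hx
  add_mem' := by
    rintro a b ⟨g, hg, hg1, hg2⟩ ⟨h, hh, hh1, hh2⟩
    refine ⟨g + h, Submodule.add_mem _ hg hh, ?_, ?_⟩
    · filter_upwards [Lp.coeFn_add a.1 b.1, hg1, hh1] with x hx h1 h2
      rw [Prod.fst_add, hx, Pi.add_apply, h1, h2, Pi.add_apply]
    · filter_upwards [Lp.coeFn_add a.2 b.2, hg2, hh2] with x hx h1 h2
      rw [Prod.snd_add, hx, Pi.add_apply, h1, h2,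
        deriv_add (differentiable_of_mem_expSpan hg x) (differentiable_of_mem_expSpan hh x),
        mul_add]
  smul_mem' := by
    rintro c a ⟨g, hg, hg1, hg2⟩
    refine ⟨c • g, Submodule.smul_mem _ c hg, ?_, ?_⟩
    · filter_upwards [Lp.coeFn_smul c a.1, hg1] with x hx h1
      rw [Prod.smul_fst, hx, Pi.smul_apply, h1, Pi.smul_apply]
    · filter_upwards [Lp.coeFn_smul c a.2, hg2] with x hx h1
      rw [Prod.smul_snd, hx, Pi.smul_apply, h1,
        deriv_const_smul c (differentiable_of_mem_expSpan hg x), smul_eq_mul, smul_eq_mul]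
      ring

/-- The operator `D_ℓ`: the closure of `-i d/dx` on the linear span of the exponentials, plus
`π / (2ℓ)` times the identity. -/
def curveDirac (ℓ : ℝ) : CurveSpace ℓ →ₗ.[ℂ] CurveSpace ℓ :=
  (((Real.pi / (2 * ℓ) : ℝ) : ℂ) • (LinearMap.id : CurveSpace ℓ →ₗ[ℂ] CurveSpace ℓ)) +ᵥ
    (derivGraph ℓ).toLinearPMap.closure

/-! ### Direct sums of operators, traces, spectral dimension -/

/-- The graph of the direct sum of a family of operators on the Hilbert space direct sum:
`x` is in the domain when each `x_j` is in the domain of `D_j` and `(D_j x_j)_j` is square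
summable, and then `x` is mapped to `(D_j x_j)_j`. -/
def directSumGraph {ι : Type*} {G : ι → Type*} [∀ i, NormedAddCommGroup (G i)]
    [∀ i, InnerProductSpace ℂ (G i)] (D : ∀ i, G i →ₗ.[ℂ] G i) :
    Submodule ℂ (lp G 2 × lp G 2) where
  carrier := {z | ∀ i, (z.1 i, z.2 i) ∈ (D i).graph}
  zero_mem' := fun i => (D i).graph.zero_mem
  add_mem' := fun ha hb i => (D i).graph.add_mem (ha i) (hb i)
  smul_mem' := fun c _ ha i => (D i).graph.smul_mem c (ha i)

/-- The direct sum of a family of (unbounded) operators. -/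
def directSumOp {ι : Type*} {G : ι → Type*} [∀ i, NormedAddCommGroup (G i)]
    [∀ i, InnerProductSpace ℂ (G i)] (D : ∀ i, G i →ₗ.[ℂ] G i) : lp G 2 →ₗ.[ℂ] lp G 2 :=
  (directSumGraph D).toLinearPMap

/-- The graph above is the graph of an operator. -/
theorem directSumOp_graph {ι : Type*} {G : ι → Type*} [∀ i, NormedAddCommGroup (G i)]
    [∀ i, InnerProductSpace ℂ (G i)] (D : ∀ i, G i →ₗ.[ℂ] G i) :
    (directSumOp D).graph = directSumGraph D := by
  refine Submodule.toLinearPMap_graph_eq _ fun z hz h0 => ?_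
  ext i
  have h := hz i
  rw [h0] at h
  exact (D i).graph_fst_eq_zero_snd h rfl

/-- `B` is the (everywhere defined, bounded) inverse of `I + D²`, the domain of `D²` being the
set of the `x` in the domain of `D` with `D x` in the domain of `D`. -/
def IsInvOneAddSq {H : Type*} [NormedAddCommGroup H] [InnerProductSpace ℂ H]
    (D : H →ₗ.[ℂ] H) (B : H →L[ℂ] H) : Prop :=
  ∀ x y : H, B y = x ↔
    ∃ (hx : x ∈ D.domain) (hDx : D ⟨x, hx⟩ ∈ D.domain), x + D ⟨D ⟨x, hx⟩, hDx⟩ = y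

/-- The trace, in `[0, ∞]`, of a positive bounded operator: the sum of the `⟨b, T b⟩` over the
members `b` of an orthonormal basis (it does not depend on the basis). -/
def posTrace {H : Type*} [NormedAddCommGroup H] [InnerProductSpace ℂ H] [CompleteSpace H]
    (T : H →L[ℂ] H) : ENNReal :=
  ∑' b : (exists_hilbertBasis ℂ H).choose, ENNReal.ofReal (inner ℂ (b : H) (T (b : H))).re

/-- The spectral dimension `inf {p > 0 : tr ((I + D²)^(-p/2)) < ∞}` of a spectral triple with
operator `D`, as an element of `[0, ∞]`. The power is that of the continuous functional calculus
of the positive bounded operator `(I + D²)⁻¹`. -/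
def spectralDim {H : Type*} [NormedAddCommGroup H] [InnerProductSpace ℂ H] [CompleteSpace H]
    (D : H →ₗ.[ℂ] H) : ENNReal :=
  sInf {d | ∃ p : ℝ, 0 < p ∧ d = ENNReal.ofReal p ∧
    ∃ B : H →L[ℂ] H, IsInvOneAddSq D B ∧ posTrace (CFC.rpow B (p / 2)) < ⊤}

/-- The Hilbert space of the spectral triple of the harmonic gasket: the direct sum, over all
edges, of the Hilbert spaces of the curves that are the images of the edges. -/
abbrev GasketSpace : Type :=
  lp (fun e : Edge => CurveSpace (edgeLength e).toReal) 2

/-- The operator of the spectral triple of the harmonic gasket. -/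
def gasketDirac : GasketSpace →ₗ.[ℂ] GasketSpace :=
  directSumOp fun e : Edge => curveDirac (edgeLength e).toReal

end

end HarmonicGasket

namespace HarmonicGasket

open MeasureTheory

noncomputable section

/-! ### Operators that are diagonal in a Hilbert basis -/

section Diagonal

variable {H : Type*} [NormedAddCommGroup H] [InnerProductSpace ℂ H]

/-- The diagonal operator with given coefficients of absolute value at most `1`. -/
theorem exists_diagonal_clm {ι : Type*} (b : HilbertBasis ι ℂ H) (c : ι → ℝ)
    (hc : ∀ i, |c i| ≤ 1) :
    ∃ B : H →L[ℂ] H, ∀ x i, inner ℂ (b i) (B x) = (c i : ℂ) * inner ℂ (b i) x := by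
  have hle : ∀ (f : lp (fun _ : ι => ℂ) 2) (i : ι), ‖(c i : ℂ) * f i‖ ≤ ‖f i‖ := by
    intro f i
    rw [norm_mul, Complex.norm_real, Real.norm_eq_abs]
    exact mul_le_of_le_one_left (norm_nonneg _) (hc i)
  have hmem : ∀ f : lp (fun _ : ι => ℂ) 2, Memℓp (fun i => (c i : ℂ) * f i) 2 :=
    fun f => (lp.memℓp f).mono' (hle f)
  let L : lp (fun _ : ι => ℂ) 2 →ₗ[ℂ] lp (fun _ : ι => ℂ) 2 :=
    { toFun := fun f => ⟨fun i => (c i : ℂ) * f i, hmem f⟩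
      map_add' := fun f g => by
        ext i
        exact mul_add _ _ _
      map_smul' := fun a f => by
        ext i
        simp [mul_left_comm] }
  have hL : ∀ f i, L f i = (c i : ℂ) * f i := fun f i => rfl
  have hnorm : ∀ f, ‖L f‖ ≤ 1 * ‖f‖ := by
    intro f
    rw [one_mul]
    have h2 : (0 : ℝ) < (2 : ENNReal).toReal := by simp
    refine (Real.rpow_le_rpow_iff (norm_nonneg _) (norm_nonneg _) h2).1 ?_
    rw [lp.norm_rpow_eq_tsum h2, lp.norm_rpow_eq_tsum h2]
    refine Summable.tsum_le_tsum (fun i => ?_) ((memℓp_gen_iff h2).1 (lp.memℓp _))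
      ((memℓp_gen_iff h2).1 (lp.memℓp _))
    exact Real.rpow_le_rpow (norm_nonneg _) (by rw [hL]; exact hle f i) h2.le
  refine ⟨(b.repr.symm : _ →L[ℂ] H) ∘L (L.mkContinuous 1 hnorm) ∘L (b.repr : H →L[ℂ] _), ?_⟩
  intro x i
  rw [← b.repr_apply_apply, ← b.repr_apply_apply]
  simp [hL]

theorem ext_inner_hilbertBasis {ι : Type*} (b : HilbertBasis ι ℂ H) {x y : H}
    (h : ∀ i, inner ℂ (b i) x = inner ℂ (b i) y) : x = y := by
  apply b.repr.injective
  ext i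
  rw [b.repr_apply_apply, b.repr_apply_apply, h]

theorem diagonal_apply_basis {ι : Type*} (b : HilbertBasis ι ℂ H) {c : ι → ℝ} {T : H →L[ℂ] H}
    (hT : ∀ x i, inner ℂ (b i) (T x) = (c i : ℂ) * inner ℂ (b i) x) (i : ι) :
    T (b i) = (c i : ℂ) • b i := by
  refine ext_inner_hilbertBasis b fun k => ?_
  rw [hT, inner_smul_right]
  rcases eq_or_ne k i with rfl | hk
  · rfl
  · rw [b.orthonormal.2 hk, mul_zero, mul_zero]

theorem hasSum_inner_diagonal {ι : Type*} (b : HilbertBasis ι ℂ H) {c : ι → ℝ} {T : H →L[ℂ] H}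
    (hT : ∀ x i, inner ℂ (b i) (T x) = (c i : ℂ) * inner ℂ (b i) x) (x : H) :
    HasSum (fun i => ((c i * ‖inner ℂ (b i) x‖ ^ 2 : ℝ) : ℂ)) (inner ℂ x (T x)) := by
  have h := b.hasSum_inner_mul_inner x (T x)
  refine h.congr_fun fun i => ?_
  rw [hT, ← inner_conj_symm x (b i)]
  push_cast
  rw [← Complex.conj_mul']
  ring

theorem diagonal_nonneg [CompleteSpace H] {ι : Type*} (b : HilbertBasis ι ℂ H) {c : ι → ℝ}
    (hc : ∀ i, 0 ≤ c i) {T : H →L[ℂ] H}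
    (hT : ∀ x i, inner ℂ (b i) (T x) = (c i : ℂ) * inner ℂ (b i) x) : 0 ≤ T := by
  rw [ContinuousLinearMap.nonneg_iff_isPositive, ContinuousLinearMap.isPositive_iff_complex]
  intro x
  have h := hasSum_inner_diagonal b hT x
  have hre : 0 ≤ (inner ℂ x (T x)).re := by
    refine (Complex.hasSum_re h).nonneg fun i => ?_
    rw [Complex.ofReal_re]
    exact mul_nonneg (hc i) (by positivity)
  have him : (inner ℂ x (T x)).im = 0 := by
    have h0 := Complex.hasSum_im h
    simp only [Complex.ofReal_im] at h0
    exact h0.unique hasSum_zero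
  have hconj : inner ℂ (T x) x = inner ℂ x (T x) := by
    rw [← inner_conj_symm (T x) x]
    exact Complex.conj_eq_iff_im.2 him
  rw [hconj]
  exact ⟨Complex.ext (Complex.ofReal_re _) ((Complex.ofReal_im _).trans him.symm), hre⟩

/-- The continuous functional calculus acts on an eigenvector through the eigenvalue. -/
theorem cfc_apply_eigenvector [CompleteSpace H] {T : H →L[ℂ] H} (hT : IsSelfAdjoint T) {f : ℝ → ℝ}
    (hf : Continuous f) {c : ℝ} {v : H} (hv : T v = (c : ℂ) • v) :
    cfc f T v = (f c : ℂ) • v := by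
  set M : ℝ := max ‖T‖ |c| * ‖(1 : H →L[ℂ] H)‖ + |c| with hM
  have hcM : |c| ≤ M := by
    have : 0 ≤ max ‖T‖ |c| * ‖(1 : H →L[ℂ] H)‖ := by positivity
    linarith
  have hspec : ∀ x ∈ spectrum ℝ T, |x| ≤ M := by
    intro x hx
    have h1 := spectrum.norm_le_norm_mul_of_mem hx
    rw [Real.norm_eq_abs] at h1
    have h2 : ‖T‖ * ‖(1 : H →L[ℂ] H)‖ ≤ max ‖T‖ |c| * ‖(1 : H →L[ℂ] H)‖ := by
      gcongr
      exact le_max_left _ _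
    have h3 := abs_nonneg c
    linarith
  have hpoly : ∀ p : Polynomial ℝ, Polynomial.aeval T p v = ((p.eval c : ℝ) : ℂ) • v := by
    intro p
    induction p using Polynomial.induction_on' with
    | add p q hp hq => simp [hp, hq, add_smul]
    | monomial n a =>
      have hpow : ∀ n : ℕ, (T ^ n) v = ((c : ℂ) ^ n) • v := by
        intro n
        induction n with
        | zero => simp
        | succ n ih =>
          rw [pow_succ', mul_apply_eq_comp, ih, map_smul, hv, smul_smul, pow_succ]
      rw [Polynomial.aeval_monomial, Polynomial.eval_monomial, Algebra.algebraMap_eq_smul_one,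
        smul_mul_assoc, one_mul, smul_apply, hpow]
      push_cast
      rw [mul_smul, Complex.coe_smul]
  have hle : ∀ ε : ℝ, 0 < ε → ‖cfc f T v - (f c : ℂ) • v‖ ≤ ε * (2 * ‖v‖) := by
    intro ε hε
    obtain ⟨p, hp⟩ := exists_polynomial_near_of_continuousOn (-M) M f hf.continuousOn ε hε
    have h1 : ‖cfc f T - Polynomial.aeval T p‖ ≤ ε := by
      rw [← cfc_polynomial p T, ← cfc_sub f p.eval T]
      refine norm_cfc_le hε.le fun x hx => ?_
      rw [Real.norm_eq_abs, abs_sub_comm]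
      exact (hp x (abs_le.1 (hspec x hx))).le
    have h2 : cfc f T v - (f c : ℂ) • v =
        (cfc f T - Polynomial.aeval T p) v + ((p.eval c - f c : ℝ) : ℂ) • v := by
      rw [sub_apply, hpoly]
      push_cast
      rw [sub_smul]
      abel
    have h3 := hp c (abs_le.1 hcM)
    rw [h2]
    refine (norm_add_le _ _).trans ?_
    rw [norm_smul, Complex.norm_real, Real.norm_eq_abs]
    have h4 := (cfc f T - Polynomial.aeval T p).le_of_opNorm_le h1 v
    have h5 : |p.eval c - f c| * ‖v‖ ≤ ε * ‖v‖ := by gcongr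
    linarith
  rw [← sub_eq_zero, ← norm_le_zero_iff]
  refine le_of_forall_pos_le_add fun δ hδ => ?_
  have h := hle (δ / (2 * ‖v‖ + 1)) (by positivity)
  refine h.trans ?_
  rw [zero_add, div_mul_eq_mul_div, div_le_iff₀ (by positivity)]
  nlinarith [norm_nonneg v]

theorem rpow_diagonal [CompleteSpace H] {ι : Type*} (b : HilbertBasis ι ℂ H) {c : ι → ℝ}
    (hc : ∀ i, 0 ≤ c i) {T : H →L[ℂ] H}
    (hT : ∀ x i, inner ℂ (b i) (T x) = (c i : ℂ) * inner ℂ (b i) x) {r : ℝ} (hr : 0 ≤ r) :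
    ∀ x i, inner ℂ (b i) (CFC.rpow T r x) = ((c i ^ r : ℝ) : ℂ) * inner ℂ (b i) x := by
  intro x i
  have h0 := diagonal_nonneg b hc hT
  have hsa : IsSelfAdjoint T := IsSelfAdjoint.of_nonneg h0
  have hS : 0 ≤ CFC.rpow T r := CFC.rpow_nonneg
  rw [ContinuousLinearMap.nonneg_iff_isPositive] at hS
  rw [← hS.inner_left_eq_inner_right]
  have h1 : CFC.rpow T r = cfc (fun x : ℝ => x ^ r) T := CFC.rpow_eq_cfc_real h0
  rw [h1, cfc_apply_eigenvector hsa (Real.continuous_rpow_const hr) (diagonal_apply_basis b hT i),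
    inner_smul_left, Complex.conj_ofReal]

theorem tsum_norm_inner_sq_hilbertBasis {ι : Type*} (b : HilbertBasis ι ℂ H) (x : H) :
    ∑' i, ENNReal.ofReal (‖inner ℂ (b i) x‖ ^ 2) = ENNReal.ofReal (‖x‖ ^ 2) := by
  have h := b.hasSum_inner_mul_inner x x
  have h1 : HasSum (fun i => ‖inner ℂ (b i) x‖ ^ 2) (‖x‖ ^ 2) := by
    have h2 := Complex.hasSum_re h
    rw [inner_self_eq_norm_sq_to_K] at h2
    convert! h2 using 1
    · ext i
      rw [← inner_conj_symm x (b i), Complex.conj_mul']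
      norm_cast
    · norm_cast
  rw [← h1.tsum_eq, ENNReal.ofReal_tsum_of_nonneg (fun i => by positivity) h1.summable]

theorem posTrace_diagonal [CompleteSpace H] {ι : Type*} (b : HilbertBasis ι ℂ H) {c : ι → ℝ}
    (hc : ∀ i, 0 ≤ c i) {T : H →L[ℂ] H}
    (hT : ∀ x i, inner ℂ (b i) (T x) = (c i : ℂ) * inner ℂ (b i) x) :
    posTrace T = ∑' i, ENNReal.ofReal (c i) := by
  unfold posTrace
  obtain ⟨w, hw⟩ := (exists_hilbertBasis ℂ H).choose_spec
  have hterm : ∀ x : H, ENNReal.ofReal (inner ℂ x (T x)).re =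
      ∑' i, ENNReal.ofReal (c i) * ENNReal.ofReal (‖inner ℂ (b i) x‖ ^ 2) := by
    intro x
    have h := Complex.hasSum_re (hasSum_inner_diagonal b hT x)
    simp only [Complex.ofReal_re] at h
    rw [← h.tsum_eq, ENNReal.ofReal_tsum_of_nonneg
      (fun i => mul_nonneg (hc i) (by positivity)) h.summable]
    exact tsum_congr fun i => ENNReal.ofReal_mul (hc i)
  simp_rw [hterm]
  rw [ENNReal.tsum_comm]
  refine tsum_congr fun i => ?_
  rw [ENNReal.tsum_mul_left]
  have h1 := tsum_norm_inner_sq_hilbertBasis w (b i)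
  rw [b.orthonormal.1 i] at h1
  have h2 : ∑' v : (exists_hilbertBasis ℂ H).choose,
      ENNReal.ofReal (‖inner ℂ (b i) (v : H)‖ ^ 2) = 1 := by
    rw [one_pow, ENNReal.ofReal_one] at h1
    rw [← h1]
    refine tsum_congr fun v => ?_
    rw [hw, norm_inner_symm]
  rw [h2, mul_one]

/-- `D` is the (maximal) diagonal operator with eigenvalues `μ` in the Hilbert basis `b`. -/
def IsDiagonal {ι : Type*} (b : HilbertBasis ι ℂ H) (μ : ι → ℝ) (D : H →ₗ.[ℂ] H) : Prop :=
  ∀ x y : H, (x, y) ∈ D.graph ↔ ∀ i, inner ℂ (b i) y = (μ i : ℂ) * inner ℂ (b i) x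

theorem isInvOneAddSq_iff {D : H →ₗ.[ℂ] H} {B : H →L[ℂ] H} :
    IsInvOneAddSq D B ↔ ∀ x y : H, B y = x ↔
      ∃ z w : H, (x, z) ∈ D.graph ∧ (z, w) ∈ D.graph ∧ x + w = y := by
  unfold IsInvOneAddSq
  refine forall_congr' fun x => forall_congr' fun y => iff_congr Iff.rfl ?_
  constructor
  · rintro ⟨hx, hDx, h⟩
    exact ⟨_, _, D.mem_graph ⟨x, hx⟩, D.mem_graph ⟨_, hDx⟩, h⟩
  · rintro ⟨z, w, hz, hw, h⟩
    have hx := LinearPMap.mem_domain_of_mem_graph hz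
    have h1 : z = D ⟨x, hx⟩ := (LinearPMap.image_iff hx).2 hz
    subst h1
    have hDx := LinearPMap.mem_domain_of_mem_graph hw
    have h2 : w = D ⟨_, hDx⟩ := (LinearPMap.image_iff hDx).2 hw
    subst h2
    exact ⟨hx, hDx, h⟩

theorem IsDiagonal.inner_of_isInvOneAddSq {ι : Type*} {b : HilbertBasis ι ℂ H} {μ : ι → ℝ}
    {D : H →ₗ.[ℂ] H} (hD : IsDiagonal b μ D) {B : H →L[ℂ] H} (hB : IsInvOneAddSq D B) (y : H)
    (i : ι) : inner ℂ (b i) (B y) = (((1 + μ i ^ 2)⁻¹ : ℝ) : ℂ) * inner ℂ (b i) y := by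
  obtain ⟨z, w, hz, hw, h⟩ := (isInvOneAddSq_iff.1 hB (B y) y).1 rfl
  have h1 := (hD _ _).1 hz i
  have h2 := (hD _ _).1 hw i
  have h3 : inner ℂ (b i) y = inner ℂ (b i) (B y) + inner ℂ (b i) w := by
    rw [← inner_add_right, h]
  have h4 : ((1 + μ i ^ 2 : ℝ) : ℂ) ≠ 0 := by
    have : (0 : ℝ) < 1 + μ i ^ 2 := by positivity
    exact_mod_cast this.ne'
  rw [h3, h2, h1, Complex.ofReal_inv, eq_inv_mul_iff_mul_eq₀ h4]
  push_cast
  ring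

theorem IsDiagonal.exists_isInvOneAddSq {ι : Type*} {b : HilbertBasis ι ℂ H} {μ : ι → ℝ}
    {D : H →ₗ.[ℂ] H} (hD : IsDiagonal b μ D) : ∃ B : H →L[ℂ] H, IsInvOneAddSq D B := by
  have hpos : ∀ i, 0 < 1 + μ i ^ 2 := fun i => by positivity
  obtain ⟨B, hB⟩ := exists_diagonal_clm b (fun i => (1 + μ i ^ 2)⁻¹) fun i => by
    rw [abs_inv, abs_of_pos (hpos i)]
    exact inv_le_one_of_one_le₀ (by nlinarith [sq_nonneg (μ i)])
  obtain ⟨Z, hZ⟩ := exists_diagonal_clm b (fun i => μ i * (1 + μ i ^ 2)⁻¹) fun i => by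
    rw [abs_mul, abs_inv, abs_of_pos (hpos i), ← div_eq_mul_inv, div_le_one (hpos i)]
    nlinarith [sq_abs (μ i), sq_nonneg (|μ i| - 1)]
  obtain ⟨W, hW⟩ := exists_diagonal_clm b (fun i => μ i ^ 2 * (1 + μ i ^ 2)⁻¹) fun i => by
    rw [abs_mul, abs_inv, abs_of_pos (hpos i), ← div_eq_mul_inv, div_le_one (hpos i),
      abs_of_nonneg (sq_nonneg _)]
    linarith
  have hne : ∀ i, ((1 + μ i ^ 2 : ℝ) : ℂ) ≠ 0 := fun i => by exact_mod_cast (hpos i).ne'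
  refine ⟨B, isInvOneAddSq_iff.2 fun x y => ⟨?_, ?_⟩⟩
  · rintro rfl
    refine ⟨Z y, W y, (hD _ _).2 fun i => ?_, (hD _ _).2 fun i => ?_,
      ext_inner_hilbertBasis b fun i => ?_⟩
    · rw [hZ, hB]; push_cast; ring
    · rw [hZ, hW]; push_cast; ring
    · have h := hne i
      rw [inner_add_right, hB, hW]
      push_cast at h ⊢
      field_simp
  · rintro ⟨z, w, hz, hw, rfl⟩
    refine ext_inner_hilbertBasis b fun i => ?_
    have h := hne i
    rw [hB, inner_add_right, (hD _ _).1 hw i, (hD _ _).1 hz i]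
    push_cast at h ⊢
    field_simp

/-- The spectral dimension of a diagonal operator in terms of its eigenvalues. -/
theorem IsDiagonal.spectralDim_eq [CompleteSpace H] {ι : Type*} {b : HilbertBasis ι ℂ H}
    {μ : ι → ℝ} {D : H →ₗ.[ℂ] H} (hD : IsDiagonal b μ D) :
    spectralDim D = sInf {d | ∃ p : ℝ, 0 < p ∧ d = ENNReal.ofReal p ∧
      ∑' i, ENNReal.ofReal ((1 + μ i ^ 2) ^ (-(p / 2))) < ⊤} := by
  have hpos : ∀ i, 0 < 1 + μ i ^ 2 := fun i => by positivity
  have htrace : ∀ (p : ℝ) (B : H →L[ℂ] H), 0 < p → IsInvOneAddSq D B →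
      posTrace (CFC.rpow B (p / 2)) = ∑' i, ENNReal.ofReal ((1 + μ i ^ 2) ^ (-(p / 2))) := by
    intro p B hp hB
    rw [posTrace_diagonal b (fun i => Real.rpow_nonneg (inv_nonneg.2 (hpos i).le) _)
      (rpow_diagonal b (fun i => inv_nonneg.2 (hpos i).le) (hD.inner_of_isInvOneAddSq hB)
        (half_pos hp).le)]
    refine tsum_congr fun i => ?_
    rw [Real.inv_rpow (hpos i).le, Real.rpow_neg (hpos i).le]
  unfold spectralDim
  congr 1
  ext d
  refine exists_congr fun p => and_congr_right fun hp => and_congr_right fun _ => ?_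
  constructor
  · rintro ⟨B, hB, h⟩
    rwa [← htrace p B hp hB]
  · intro h
    obtain ⟨B, hB⟩ := hD.exists_isInvOneAddSq
    exact ⟨B, hB, by rwa [htrace p B hp hB]⟩

end Diagonal

/-! ### Direct sums of diagonal operators -/

theorem exists_hilbertBasis_lp {ι : Type*} {G : ι → Type*} [∀ i, NormedAddCommGroup (G i)]
    [∀ i, InnerProductSpace ℂ (G i)] [∀ i, CompleteSpace (G i)] {κ : ι → Type*}
    (b : ∀ i, HilbertBasis (κ i) ℂ (G i)) :
    ∃ B : HilbertBasis (Σ i, κ i) ℂ (lp G 2),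
      ∀ (s : Σ i, κ i) (x : lp G 2), inner ℂ (B s) x = inner ℂ (b s.1 s.2) (x s.1) := by
  classical
  let v : (Σ i, κ i) → lp G 2 := fun s => lp.single 2 s.1 (b s.1 s.2)
  have hv : ∀ s (x : lp G 2), inner ℂ (v s) x = inner ℂ (b s.1 s.2) (x s.1) :=
    fun s x => lp.inner_single_left _ _ _
  have hon : Orthonormal ℂ v := by
    rw [orthonormal_iff_ite]
    rintro ⟨i, k⟩ ⟨j, l⟩
    rw [hv]
    rcases eq_or_ne i j with rfl | hij
    · have h1 : v ⟨i, l⟩ i = b i l := lp.single_apply_self _ _ _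
      simp only [h1]
      rw [orthonormal_iff_ite.1 (b i).orthonormal k l]
      simp
    · have h1 : v ⟨j, l⟩ i = 0 := by
        change Pi.single j (b j l) i = 0
        exact Pi.single_eq_of_ne hij _
      simp only [h1, inner_zero_right]
      rw [if_neg]
      intro h
      exact hij (congrArg Sigma.fst h)
  have htot : (Submodule.span ℂ (Set.range v))ᗮ = ⊥ := by
    rw [Submodule.eq_bot_iff]
    intro x hx
    ext i
    refine ext_inner_hilbertBasis (b i) fun k => ?_
    have h1 := (Submodule.mem_orthogonal _ _).1 hx (v ⟨i, k⟩)
      (Submodule.subset_span (Set.mem_range_self _))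
    rw [hv] at h1
    simpa using h1
  refine ⟨HilbertBasis.mkOfOrthogonalEqBot hon htot, fun s x => ?_⟩
  rw [HilbertBasis.coe_mkOfOrthogonalEqBot]
  exact hv s x

theorem IsDiagonal.directSumOp {ι : Type*} {G : ι → Type*} [∀ i, NormedAddCommGroup (G i)]
    [∀ i, InnerProductSpace ℂ (G i)] {κ : ι → Type*}
    {b : ∀ i, HilbertBasis (κ i) ℂ (G i)} {μ : ∀ i, κ i → ℝ} {D : ∀ i, G i →ₗ.[ℂ] G i}
    (hD : ∀ i, IsDiagonal (b i) (μ i) (D i)) {B : HilbertBasis (Σ i, κ i) ℂ (lp G 2)}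
    (hB : ∀ (s : Σ i, κ i) (x : lp G 2), inner ℂ (B s) x = inner ℂ (b s.1 s.2) (x s.1)) :
    IsDiagonal B (fun s => μ s.1 s.2) (directSumOp D) := by
  intro x y
  rw [directSumOp_graph]
  change (∀ i, (x i, y i) ∈ (D i).graph) ↔ _
  simp_rw [hD _ _ _, hB]
  exact ⟨fun h s => h s.1 s.2, fun h i k => h ⟨i, k⟩⟩

/-! ### The operator of a curve is diagonal -/

section DiagonalGraph

variable {H : Type*} [NormedAddCommGroup H] [InnerProductSpace ℂ H]

/-- The graph of the maximal diagonal operator with eigenvalues `μ`. -/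
def diagonalGraph {ι : Type*} (b : HilbertBasis ι ℂ H) (μ : ι → ℝ) : Submodule ℂ (H × H) where
  carrier := {z | ∀ i, inner ℂ (b i) z.2 = (μ i : ℂ) * inner ℂ (b i) z.1}
  zero_mem' := fun i => by simp
  add_mem' := fun hx hy i => by
    rw [Prod.fst_add, Prod.snd_add, inner_add_right, inner_add_right, hx i, hy i, mul_add]
  smul_mem' := fun c x hx i => by
    rw [Prod.smul_fst, Prod.smul_snd, inner_smul_right, inner_smul_right, hx i, mul_left_comm]

theorem mem_diagonalGraph {ι : Type*} {b : HilbertBasis ι ℂ H} {μ : ι → ℝ} {z : H × H} :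
    z ∈ diagonalGraph b μ ↔ ∀ i, inner ℂ (b i) z.2 = (μ i : ℂ) * inner ℂ (b i) z.1 :=
  Iff.rfl

theorem snd_eq_zero_of_mem_diagonalGraph {ι : Type*} {b : HilbertBasis ι ℂ H} {μ : ι → ℝ}
    {z : H × H} (hz : z ∈ diagonalGraph b μ) (h0 : z.1 = 0) : z.2 = 0 :=
  ext_inner_hilbertBasis b fun i => by rw [mem_diagonalGraph.1 hz i, h0, inner_zero_right, mul_zero]

theorem isClosed_diagonalGraph {ι : Type*} (b : HilbertBasis ι ℂ H) (μ : ι → ℝ) :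
    IsClosed (diagonalGraph b μ : Set (H × H)) := by
  have h : (diagonalGraph b μ : Set (H × H)) =
      ⋂ i, {z : H × H | inner ℂ (b i) z.2 = (μ i : ℂ) * inner ℂ (b i) z.1} := by
    ext z
    simp [mem_diagonalGraph]
  rw [h]
  refine isClosed_iInter fun i => isClosed_eq ?_ ?_ <;> fun_prop

theorem topologicalClosure_span_diagonal {ι : Type*} (b : HilbertBasis ι ℂ H) (μ : ι → ℝ) :
    (Submodule.span ℂ (Set.range fun i => (b i, (μ i : ℂ) • b i))).topologicalClosure =
      diagonalGraph b μ := by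
  apply le_antisymm
  · refine Submodule.topologicalClosure_minimal _ (Submodule.span_le.2 ?_)
      (isClosed_diagonalGraph b μ)
    rintro _ ⟨i, rfl⟩ k
    rw [inner_smul_right]
    rcases eq_or_ne k i with rfl | hk
    · rfl
    · rw [b.orthonormal.2 hk, mul_zero, mul_zero]
  · rintro ⟨x, y⟩ hz
    have h1 : HasSum (fun i => inner ℂ (b i) x • (b i, (μ i : ℂ) • b i)) (x, y) := by
      refine HasSum.prodMk ?_ ?_
      · simpa only [b.repr_apply_apply] using b.hasSum_repr x
      · convert b.hasSum_repr y using 2 with i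
        rw [b.repr_apply_apply, mem_diagonalGraph.1 hz i, smul_smul, mul_comm]
    refine (Submodule.isClosed_topologicalClosure _).mem_of_tendsto h1
      (Filter.Eventually.of_forall fun s => ?_)
    refine Submodule.le_topologicalClosure _ (Submodule.sum_mem _ fun i _ => ?_)
    exact Submodule.smul_mem _ _ (Submodule.subset_span (Set.mem_range_self i))

theorem isDiagonal_closure_span {ι : Type*} (b : HilbertBasis ι ℂ H) (μ : ι → ℝ) :
    IsDiagonal b μ
      (Submodule.span ℂ (Set.range fun i => (b i, (μ i : ℂ) • b i))).toLinearPMap.closure := by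
  set S := Submodule.span ℂ (Set.range fun i => (b i, (μ i : ℂ) • b i)) with hS
  have hcl : S.topologicalClosure = diagonalGraph b μ := topologicalClosure_span_diagonal b μ
  have hgraph : S.toLinearPMap.graph = S := Submodule.toLinearPMap_graph_eq _ fun z hz h0 =>
    snd_eq_zero_of_mem_diagonalGraph (hcl ▸ Submodule.le_topologicalClosure S hz) h0
  have hclosable : S.toLinearPMap.IsClosable := by
    refine ⟨(diagonalGraph b μ).toLinearPMap, ?_⟩
    rw [hgraph, hcl, Submodule.toLinearPMap_graph_eq]
    exact fun z hz h0 => snd_eq_zero_of_mem_diagonalGraph hz h0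
  intro x y
  rw [← hclosable.graph_closure_eq_closure_graph, hgraph, hcl]
  exact mem_diagonalGraph

theorem IsDiagonal.const_vadd {ι : Type*} {b : HilbertBasis ι ℂ H} {μ : ι → ℝ}
    {D : H →ₗ.[ℂ] H} (hD : IsDiagonal b μ D) (c : ℝ) :
    IsDiagonal b (fun i => μ i + c) (((c : ℂ) • (LinearMap.id : H →ₗ[ℂ] H)) +ᵥ D) := by
  intro x y
  have h : (x, y) ∈ (((c : ℂ) • (LinearMap.id : H →ₗ[ℂ] H)) +ᵥ D).graph ↔
      (x, y - (c : ℂ) • x) ∈ D.graph := by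
    rw [LinearPMap.mem_graph_iff, LinearPMap.mem_graph_iff]
    constructor
    · rintro ⟨z, hz, h⟩
      refine ⟨z, hz, ?_⟩
      dsimp only at hz h ⊢
      rw [← h, ← hz, LinearPMap.vadd_apply]
      simp
    · rintro ⟨z, hz, h⟩
      refine ⟨z, hz, ?_⟩
      dsimp only at hz h ⊢
      rw [LinearPMap.vadd_apply]
      have h2 := sub_eq_iff_eq_add.1 h.symm
      rw [h2, ← hz]
      simp [add_comm]
  rw [h, hD]
  refine forall_congr' fun i => ?_
  rw [inner_sub_right, inner_smul_right, sub_eq_iff_eq_add]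
  push_cast
  rw [add_mul]

end DiagonalGraph

/-! ### The exponential basis -/

theorem measurePreserving_curve {ℓ : ℝ} [Fact (0 < 2 * ℓ)] :
    MeasurePreserving ((↑) : ℝ → AddCircle (2 * ℓ)) (curveMeasure ℓ) AddCircle.haarAddCircle := by
  have h := AddCircle.measurePreserving_mk (2 * ℓ) (-ℓ)
  have h2 : -ℓ + 2 * ℓ = ℓ := by ring
  have hpos : (0 : ℝ) < 2 * ℓ := Fact.out
  rw [h2] at h
  have hvol : (AddCircle.haarAddCircle : Measure (AddCircle (2 * ℓ))) =
      (ENNReal.ofReal (2 * ℓ))⁻¹ • volume := by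
    rw [AddCircle.volume_eq_smul_haarAddCircle, smul_smul, ENNReal.inv_mul_cancel, one_smul]
    · simpa using hpos
    · exact ENNReal.ofReal_ne_top
  refine ⟨h.measurable, ?_⟩
  rw [hvol, ← h.map_eq, curveMeasure, Measure.map_smul, restrict_Ioc_eq_restrict_Icc]

theorem equivIoc_coe_ae_eq {ℓ : ℝ} [Fact (0 < 2 * ℓ)] :
    (fun x : ℝ => (AddCircle.equivIoc (2 * ℓ) (-ℓ) (x : AddCircle (2 * ℓ)) : ℝ))
      =ᵐ[curveMeasure ℓ] id := by
  have h1 : ∀ᵐ x : ℝ ∂(volume.restrict (Set.Ioc (-ℓ) ℓ)),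
      (AddCircle.equivIoc (2 * ℓ) (-ℓ) (x : AddCircle (2 * ℓ)) : ℝ) = x := by
    refine (ae_restrict_iff' measurableSet_Ioc).2 (Filter.Eventually.of_forall fun x hx => ?_)
    have hx' : x ∈ Set.Ioc (-ℓ) (-ℓ + 2 * ℓ) := by
      rwa [show -ℓ + 2 * ℓ = ℓ by ring]
    rw [AddCircle.equivIoc_coe_of_mem hx']
  rw [restrict_Ioc_eq_restrict_Icc] at h1
  exact Measure.ae_smul_measure h1 _

theorem measurePreserving_curve_section {ℓ : ℝ} [Fact (0 < 2 * ℓ)] :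
    MeasurePreserving (fun x : AddCircle (2 * ℓ) => (AddCircle.equivIoc (2 * ℓ) (-ℓ) x : ℝ))
      AddCircle.haarAddCircle (curveMeasure ℓ) := by
  have hm : Measurable (fun x : AddCircle (2 * ℓ) => (AddCircle.equivIoc (2 * ℓ) (-ℓ) x : ℝ)) :=
    measurable_subtype_coe.comp (AddCircle.measurableEquivIoc (2 * ℓ) (-ℓ)).measurable
  refine ⟨hm, ?_⟩
  have h := measurePreserving_curve (ℓ := ℓ)
  rw [← h.map_eq, Measure.map_map hm h.measurable]
  exact (Measure.map_congr equivIoc_coe_ae_eq).trans Measure.map_id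

/-- The exponentials form a Hilbert basis. -/
theorem exists_hilbertBasis_expFun {ℓ : ℝ} (hℓ : 0 < ℓ) :
    ∃ b : HilbertBasis ℤ ℂ (CurveSpace ℓ), ∀ k, b k =ᵐ[curveMeasure ℓ] expFun ℓ k := by
  have : Fact (0 < 2 * ℓ) := ⟨by positivity⟩
  let U : Lp ℂ 2 (AddCircle.haarAddCircle (T := 2 * ℓ)) →ₗᵢ[ℂ] CurveSpace ℓ :=
    Lp.compMeasurePreservingₗᵢ ℂ _ measurePreserving_curve
  have hU : ∀ g, U g =ᵐ[curveMeasure ℓ] g ∘ ((↑) : ℝ → AddCircle (2 * ℓ)) :=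
    fun g => Lp.coeFn_compMeasurePreserving g measurePreserving_curve
  have hsurj : Function.Surjective U := by
    intro f
    refine ⟨Lp.compMeasurePreserving _ measurePreserving_curve_section f, Lp.ext ?_⟩
    have h1 := Lp.coeFn_compMeasurePreserving f (measurePreserving_curve_section (ℓ := ℓ))
    have h2 := (measurePreserving_curve (ℓ := ℓ)).quasiMeasurePreserving.ae_eq_comp h1
    refine (hU _).trans (h2.trans ?_)
    filter_upwards [equivIoc_coe_ae_eq (ℓ := ℓ)] with x hx
    simp only [Function.comp_apply]
    rw [hx, id]
  let b : HilbertBasis ℤ ℂ (CurveSpace ℓ) :=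
    HilbertBasis.ofRepr ((LinearIsometryEquiv.ofSurjective U hsurj).symm.trans fourierBasis.repr)
  refine ⟨b, fun k => ?_⟩
  have hb : b k = U (fourierBasis k) := by
    rw [← b.repr_symm_single, ← fourierBasis.repr_symm_single]
    rfl
  rw [hb, coe_fourierBasis]
  refine (hU _).trans ?_
  refine ((measurePreserving_curve (ℓ := ℓ)).quasiMeasurePreserving.ae_eq_comp
    (coeFn_fourierLp 2 k)).trans (Filter.Eventually.of_forall fun x => ?_)
  rw [Function.comp_apply, fourier_coe_apply, expFun]
  congr 1
  push_cast
  have : (ℓ : ℂ) ≠ 0 := by exact_mod_cast hℓ.ne'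
  field_simp

theorem neg_I_mul_deriv_expFun (ℓ : ℝ) (k : ℤ) (x : ℝ) :
    -Complex.I * deriv (expFun ℓ k) x = ((Real.pi * k / ℓ : ℝ) : ℂ) * expFun ℓ k x := by
  have h0 : HasDerivAt (fun y : ℝ => Complex.I * Real.pi * k * (y : ℂ) / ℓ)
      (Complex.I * Real.pi * k * 1 / ℓ) x :=
    ((Complex.ofRealCLM.hasDerivAt (x := x)).const_mul _).div_const _
  have h1 : HasDerivAt (expFun ℓ k) _ x := h0.cexp
  rw [h1.deriv, expFun]
  push_cast
  linear_combination (-(Real.pi : ℂ) * k / ℓ *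
    Complex.exp (Complex.I * Real.pi * k * x / ℓ)) * Complex.I_mul_I

theorem derivGraph_eq_span {ℓ : ℝ} (b : HilbertBasis ℤ ℂ (CurveSpace ℓ))
    (hb : ∀ k, b k =ᵐ[curveMeasure ℓ] expFun ℓ k) :
    derivGraph ℓ = Submodule.span ℂ
      (Set.range fun k => (b k, ((Real.pi * k / ℓ : ℝ) : ℂ) • b k)) := by
  set S := Submodule.span ℂ (Set.range fun k : ℤ => (b k, ((Real.pi * k / ℓ : ℝ) : ℂ) • b k))
  apply le_antisymm
  · have key : ∀ g ∈ expSpan ℓ, ∃ z ∈ S, z.1 =ᵐ[curveMeasure ℓ] g ∧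
        z.2 =ᵐ[curveMeasure ℓ] fun x => -Complex.I * deriv g x := by
      intro g hg
      induction hg using Submodule.span_induction with
      | mem g hg =>
        obtain ⟨k, rfl⟩ := hg
        refine ⟨_, Submodule.subset_span (Set.mem_range_self k), hb k, ?_⟩
        filter_upwards [hb k, Lp.coeFn_smul ((Real.pi * k / ℓ : ℝ) : ℂ) (b k)] with x h1 h2
        rw [h2, Pi.smul_apply, h1, neg_I_mul_deriv_expFun, smul_eq_mul]
      | zero =>
        refine ⟨0, S.zero_mem, Lp.coeFn_zero _ _ _, ?_⟩
        filter_upwards [Lp.coeFn_zero ℂ 2 (curveMeasure ℓ)] with x hx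
        simpa [Pi.zero_def] using hx
      | add g h hg hh ihg ihh =>
        obtain ⟨z, hz, hz1, hz2⟩ := ihg
        obtain ⟨w, hw, hw1, hw2⟩ := ihh
        refine ⟨z + w, S.add_mem hz hw, ?_, ?_⟩
        · filter_upwards [Lp.coeFn_add z.1 w.1, hz1, hw1] with x hx h1 h2
          rw [Prod.fst_add, hx, Pi.add_apply, h1, h2, Pi.add_apply]
        · filter_upwards [Lp.coeFn_add z.2 w.2, hz2, hw2] with x hx h1 h2
          rw [Prod.snd_add, hx, Pi.add_apply, h1, h2,
            deriv_add (differentiable_of_mem_expSpan hg x)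
              (differentiable_of_mem_expSpan hh x), mul_add]
      | smul c g hg ih =>
        obtain ⟨z, hz, hz1, hz2⟩ := ih
        refine ⟨c • z, S.smul_mem c hz, ?_, ?_⟩
        · filter_upwards [Lp.coeFn_smul c z.1, hz1] with x hx h1
          rw [Prod.smul_fst, hx, Pi.smul_apply, h1, Pi.smul_apply]
        · filter_upwards [Lp.coeFn_smul c z.2, hz2] with x hx h1
          rw [Prod.smul_snd, hx, Pi.smul_apply, h1,
            deriv_const_smul c (differentiable_of_mem_expSpan hg x), smul_eq_mul, smul_eq_mul]
          ring
    rintro ⟨x, y⟩ ⟨g, hg, h1, h2⟩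
    obtain ⟨z, hz, hz1, hz2⟩ := key g hg
    have hx : x = z.1 := Lp.ext (h1.trans hz1.symm)
    have hy : y = z.2 := Lp.ext (h2.trans hz2.symm)
    rw [hx, hy]
    exact hz
  · refine Submodule.span_le.2 ?_
    rintro _ ⟨k, rfl⟩
    refine ⟨expFun ℓ k, Submodule.subset_span (Set.mem_range_self k), hb k, ?_⟩
    filter_upwards [hb k, Lp.coeFn_smul ((Real.pi * k / ℓ : ℝ) : ℂ) (b k)] with x h1 h2
    rw [h2, Pi.smul_apply, h1, neg_I_mul_deriv_expFun, smul_eq_mul]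

theorem exists_isDiagonal_curveDirac {ℓ : ℝ} (hℓ : 0 < ℓ) :
    ∃ b : HilbertBasis ℤ ℂ (CurveSpace ℓ),
      IsDiagonal b (fun k => Real.pi * (2 * k + 1) / (2 * ℓ)) (curveDirac ℓ) := by
  obtain ⟨b, hb⟩ := exists_hilbertBasis_expFun hℓ
  refine ⟨b, ?_⟩
  have h := (isDiagonal_closure_span b fun k : ℤ => Real.pi * k / ℓ).const_vadd
    (Real.pi / (2 * ℓ))
  rw [← derivGraph_eq_span b hb] at h
  have hμ : (fun k : ℤ => Real.pi * (2 * k + 1) / (2 * ℓ)) =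
      fun k : ℤ => Real.pi * k / ℓ + Real.pi / (2 * ℓ) := by
    ext k
    field_simp
  rw [hμ]
  exact h

/-! ### Barycentric coordinates and the self-similarity of the gasket -/

/-- Barycentric coordinates with respect to the corners. -/
def bary (x : EuclideanSpace ℝ (Fin 2)) : Fin 3 → ℝ :=
  ![1 - x 0 - x 1 / Real.sqrt 3, 2 * x 1 / Real.sqrt 3, x 0 - x 1 / Real.sqrt 3]

/-- The inverse of `contr j`. -/
def expand (j : Fin 3) (x : EuclideanSpace ℝ (Fin 2)) : EuclideanSpace ℝ (Fin 2) :=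
  (2 : ℝ) • x - corner j

theorem bary_sum (x : EuclideanSpace ℝ (Fin 2)) : bary x 0 + bary x 1 + bary x 2 = 1 := by
  simp [bary]
  ring

theorem bary_injective : Function.Injective bary := by
  intro x y h
  have h3 : Real.sqrt 3 ≠ 0 := by positivity
  have h1 := congrFun h 1
  have h2 := congrFun h 2
  simp [bary] at h1 h2
  rw [h1] at h2
  ext i
  fin_cases i
  · simpa using h2
  · exact h1

theorem bary_corner (j k : Fin 3) : bary (corner j) k = if k = j then 1 else 0 := by
  have h3 : Real.sqrt 3 ≠ 0 := by positivity
  fin_cases j <;> fin_cases k <;> simp [bary, corner] <;> field_simp <;> norm_num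

theorem bary_expand (j : Fin 3) (x : EuclideanSpace ℝ (Fin 2)) (k : Fin 3) :
    bary (expand j x) k = 2 * bary x k - if k = j then 1 else 0 := by
  rw [← bary_corner j k]
  fin_cases k <;> simp [bary, expand] <;> ring

theorem expand_contr (j : Fin 3) (x : EuclideanSpace ℝ (Fin 2)) : expand j (contr j x) = x := by
  ext i
  simp [contr, expand]
  ring

theorem bary_contr (j : Fin 3) (x : EuclideanSpace ℝ (Fin 2)) (k : Fin 3) :
    bary (contr j x) k = (bary x k + if k = j then 1 else 0) / 2 := by
  have h := bary_expand j (contr j x) k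
  rw [expand_contr] at h
  linarith

theorem contr_corner_self (j : Fin 3) : contr j (corner j) = corner j := by
  simp [contr]

theorem contr_corner_comm (j k : Fin 3) : contr j (corner k) = contr k (corner j) := by
  ext i
  simp [contr]
  ring

@[fun_prop]
theorem continuous_bary : Continuous bary := by
  unfold bary
  refine continuous_pi fun k => ?_
  fin_cases k <;> simp <;> fun_prop

@[fun_prop]
theorem continuous_contr (j : Fin 3) : Continuous (contr j) := by
  unfold contr
  fun_prop

@[fun_prop]
theorem continuous_expand (j : Fin 3) : Continuous (expand j) := by
  unfold expand
  fun_prop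

theorem contr_lineMap (j : Fin 3) (x y : EuclideanSpace ℝ (Fin 2)) (t : ℝ) :
    contr j (AffineMap.lineMap x y t) = AffineMap.lineMap (contr j x) (contr j y) t := by
  ext i
  simp [contr, AffineMap.lineMap_apply]
  ring

theorem contrWord_cons (j : Fin 3) (w : List (Fin 3)) (x : EuclideanSpace ℝ (Fin 2)) :
    contrWord (j :: w) x = contrWord w (contr j x) :=
  rfl

theorem contrWord_append_singleton (w : List (Fin 3)) (j : Fin 3)
    (x : EuclideanSpace ℝ (Fin 2)) : contrWord (w ++ [j]) x = contr j (contrWord w x) := by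
  simp [contrWord]

theorem contrWord_lineMap (w : List (Fin 3)) (x y : EuclideanSpace ℝ (Fin 2)) (t : ℝ) :
    contrWord w (AffineMap.lineMap x y t) =
      AffineMap.lineMap (contrWord w x) (contrWord w y) t := by
  induction w generalizing x y with
  | nil => rfl
  | cons j w ih => rw [contrWord_cons, contr_lineMap, ih]; rfl

theorem lineMap_mem_triangle (i : Fin 3) {t : ℝ} (ht : t ∈ Set.Icc (0 : ℝ) 1) :
    AffineMap.lineMap (corner i) (corner (i + 1)) t ∈ triangle := by
  refine Set.mem_iUnion.2 ⟨i, ?_⟩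
  rw [segment_eq_image_lineMap]
  exact Set.mem_image_of_mem _ ht

theorem contrWord_mem_gasket {x : EuclideanSpace ℝ (Fin 2)} (hx : x ∈ triangle)
    (w : List (Fin 3)) : contrWord w x ∈ gasket := by
  refine subset_closure (Set.mem_iUnion.2 ⟨w.length, ?_⟩)
  exact Set.mem_biUnion (x := w) rfl (Set.mem_image_of_mem _ hx)

theorem triangle_subset_gasket : triangle ⊆ gasket := fun _ hx => contrWord_mem_gasket hx []

theorem corner_mem_gasket (k : Fin 3) : corner k ∈ gasket := by
  have h := lineMap_mem_triangle k (t := 0) (by simp)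
  rw [AffineMap.lineMap_apply_zero] at h
  exact triangle_subset_gasket h

theorem contr_mem_gasket (j : Fin 3) {x : EuclideanSpace ℝ (Fin 2)} (hx : x ∈ gasket) :
    contr j x ∈ gasket := by
  refine Set.MapsTo.closure (f := contr j) ?_ (continuous_contr j) hx
  intro y hy
  obtain ⟨n, hn⟩ := Set.mem_iUnion.1 hy
  obtain ⟨w, hw, z, hz, rfl⟩ := Set.mem_iUnion₂.1 hn
  refine Set.mem_iUnion.2 ⟨n + 1, Set.mem_biUnion (x := w ++ [j]) ?_ ⟨z, hz, ?_⟩⟩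
  · simpa using hw
  · exact contrWord_append_singleton w j z

theorem bary_nonneg_of_mem_gasket {x : EuclideanSpace ℝ (Fin 2)} (hx : x ∈ gasket) (k : Fin 3) :
    0 ≤ bary x k := by
  have hclosed : IsClosed {x : EuclideanSpace ℝ (Fin 2) | ∀ k, 0 ≤ bary x k} := by
    simp only [Set.ofPred_forall]
    exact isClosed_iInter fun k => isClosed_le continuous_const (by fun_prop)
  refine closure_minimal ?_ hclosed hx k
  intro y hy
  obtain ⟨n, hn⟩ := Set.mem_iUnion.1 hy
  obtain ⟨w, -, z, hz, rfl⟩ := Set.mem_iUnion₂.1 hn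
  have hz' : ∀ k, 0 ≤ bary z k := by
    obtain ⟨i, hi⟩ := Set.mem_iUnion.1 hz
    obtain ⟨a, b, ha, hb, hab, rfl⟩ := hi
    intro k
    have h : bary (a • corner i + b • corner (i + 1)) k =
        a * bary (corner i) k + b * bary (corner (i + 1)) k := by
      have hb' : b = 1 - a := by linarith
      subst hb'
      fin_cases k <;> simp [bary] <;> ring
    rw [h, bary_corner, bary_corner]
    positivity
  clear hy hn hz
  induction w generalizing z with
  | nil => exact hz'
  | cons j w ih =>
    refine ih (contr j z) fun k => ?_
    rw [bary_contr]
    have := hz' k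
    positivity

theorem exists_expand_mem_gasket {x : EuclideanSpace ℝ (Fin 2)} (hx : x ∈ gasket) :
    ∃ j, expand j x ∈ gasket := by
  have hclosed : IsClosed (⋃ j, expand j ⁻¹' gasket) :=
    isClosed_iUnion_of_finite fun j => isClosed_closure.preimage (continuous_expand j)
  refine Set.mem_iUnion.1 (closure_minimal ?_ hclosed hx)
  intro y hy
  obtain ⟨n, hn⟩ := Set.mem_iUnion.1 hy
  obtain ⟨w, -, z, hz, rfl⟩ := Set.mem_iUnion₂.1 hn
  rcases List.eq_nil_or_concat w with rfl | ⟨w, j, rfl⟩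
  · obtain ⟨i, hi⟩ := Set.mem_iUnion.1 hz
    rw [segment_eq_image_lineMap] at hi
    obtain ⟨t, ht, rfl⟩ := hi
    change AffineMap.lineMap (corner i) (corner (i + 1)) t ∈ _
    rcases le_total t (1 / 2) with h | h
    · refine Set.mem_iUnion.2 ⟨i, ?_⟩
      have h1 : expand i (AffineMap.lineMap (corner i) (corner (i + 1)) t) =
          AffineMap.lineMap (corner i) (corner (i + 1)) (2 * t) := by
        ext k
        simp [expand, AffineMap.lineMap_apply]
        ring
      rw [Set.mem_preimage, h1]
      exact triangle_subset_gasket (lineMap_mem_triangle i ⟨by linarith [ht.1], by linarith⟩)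
    · refine Set.mem_iUnion.2 ⟨i + 1, ?_⟩
      have h1 : expand (i + 1) (AffineMap.lineMap (corner i) (corner (i + 1)) t) =
          AffineMap.lineMap (corner i) (corner (i + 1)) (2 * t - 1) := by
        ext k
        simp [expand, AffineMap.lineMap_apply]
        ring
      rw [Set.mem_preimage, h1]
      exact triangle_subset_gasket (lineMap_mem_triangle i ⟨by linarith, by linarith [ht.2]⟩)
  · refine Set.mem_iUnion.2 ⟨j, ?_⟩
    rw [Set.mem_preimage, List.concat_eq_append, contrWord_append_singleton, expand_contr]
    exact contrWord_mem_gasket hz w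

/-- Two different cells of level one meet in a single point. -/
theorem expand_eq_corner {x : EuclideanSpace ℝ (Fin 2)} (hx : ∀ k, 0 ≤ bary x k) {i j : Fin 3}
    (hij : i ≠ j) (hi : 1 / 2 ≤ bary x i) (hj : 1 / 2 ≤ bary x j) : expand i x = corner j := by
  apply bary_injective
  ext k
  rw [bary_expand, bary_corner]
  have hs := bary_sum x
  have h0 := hx 0
  have h1 := hx 1
  have h2 := hx 2
  fin_cases i <;> fin_cases j <;> fin_cases k <;> simp at hij hi hj ⊢ <;> linarith

theorem expand_mem_gasket {x : EuclideanSpace ℝ (Fin 2)} (hx : x ∈ gasket) {i : Fin 3}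
    (hi : 1 / 2 ≤ bary x i) : expand i x ∈ gasket := by
  obtain ⟨j, hj⟩ := exists_expand_mem_gasket hx
  rcases eq_or_ne i j with rfl | hij
  · exact hj
  · have h := bary_nonneg_of_mem_gasket hj j
    rw [bary_expand, if_pos rfl] at h
    rw [expand_eq_corner (bary_nonneg_of_mem_gasket hx) hij hi (by linarith)]
    exact corner_mem_gasket j

theorem exists_half_le_bary {x : EuclideanSpace ℝ (Fin 2)} (hx : x ∈ gasket) :
    ∃ j, 1 / 2 ≤ bary x j := by
  obtain ⟨j, hj⟩ := exists_expand_mem_gasket hx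
  have h := bary_nonneg_of_mem_gasket hj j
  rw [bary_expand, if_pos rfl] at h
  exact ⟨j, by linarith⟩

/-! ### Existence of the harmonic coordinates -/

/-- The harmonic extension matrices: column `k` of `extMatrix j` holds the values of the three
harmonic coordinates at `contr j (corner k)`. -/
def extMatrix (j : Fin 3) : Matrix (Fin 3) (Fin 3) ℝ :=
  Matrix.of fun i k =>
    if k = j then (if i = j then 1 else 0) else if i = j ∨ i = k then 2 / 5 else 1 / 5

theorem extMatrix_sum_col (j k : Fin 3) : ∑ i, extMatrix j i k = 1 := by
  rw [Fin.sum_univ_three]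
  fin_cases j <;> fin_cases k <;> simp [extMatrix] <;> norm_num

theorem extMatrix_comm (j k i : Fin 3) : extMatrix j i k = extMatrix k i j := by
  fin_cases j <;> fin_cases k <;> fin_cases i <;> simp [extMatrix]

theorem det_extMatrix_ne_zero (j : Fin 3) : (extMatrix j).det ≠ 0 := by
  rw [Matrix.det_fin_three]
  fin_cases j <;> simp [extMatrix] <;> norm_num

theorem sum_extMatrix_mulVec (j : Fin 3) (y : Fin 3 → ℝ) :
    ∑ i, (extMatrix j).mulVec y i = ∑ k, y k := by
  simp only [Matrix.mulVec, dotProduct]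
  rw [Finset.sum_comm]
  refine Finset.sum_congr rfl fun k _ => ?_
  rw [← Finset.sum_mul, extMatrix_sum_col, one_mul]

/-- The extension matrices contract the vectors of sum zero by `3 / 5`. -/
theorem norm_extMatrix_mulVec_le (j : Fin 3) {y : Fin 3 → ℝ} (hy : ∑ k, y k = 0) :
    ‖(extMatrix j).mulVec y‖ ≤ 3 / 5 * ‖y‖ := by
  refine (pi_norm_le_iff_of_nonneg (by positivity)).2 fun i => ?_
  have h0 := norm_le_pi_norm y 0
  have h1 := norm_le_pi_norm y 1
  have h2 := norm_le_pi_norm y 2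
  rw [Real.norm_eq_abs, abs_le] at h0 h1 h2
  rw [Fin.sum_univ_three] at hy
  rw [Real.norm_eq_abs, abs_le]
  simp only [Matrix.mulVec, dotProduct, Fin.sum_univ_three]
  fin_cases j <;> fin_cases i <;> simp [extMatrix] <;> constructor <;> linarith

open Classical in
/-- A cell of level one that contains the point. -/
def digit (x : EuclideanSpace ℝ (Fin 2)) : Fin 3 :=
  if h : ∃ j, 1 / 2 ≤ bary x j then h.choose else 0

theorem half_le_bary_digit {x : EuclideanSpace ℝ (Fin 2)} (hx : ∃ j, 1 / 2 ≤ bary x j) :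
    1 / 2 ≤ bary x (digit x) := by
  unfold digit
  rw [dif_pos hx]
  exact hx.choose_spec

/-- The interpolations of the harmonic map: affine on the cells of level `n`. -/
def approx : ℕ → EuclideanSpace ℝ (Fin 2) → Fin 3 → ℝ
  | 0, x => bary x
  | n + 1, x => (extMatrix (digit x)).mulVec (approx n (expand (digit x) x))

theorem digit_corner (k : Fin 3) : digit (corner k) = k := by
  have h := half_le_bary_digit (x := corner k) ⟨k, by rw [bary_corner]; norm_num⟩
  rw [bary_corner] at h
  by_contra hne
  rw [if_neg hne] at h
  norm_num at h

theorem expand_corner (k : Fin 3) : expand k (corner k) = corner k := by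
  ext i
  simp [expand]
  ring

theorem extMatrix_mulVec_single (j k : Fin 3) :
    (extMatrix j).mulVec (Pi.single k 1) = fun i => extMatrix j i k := by
  ext i
  simp

theorem approx_corner (n : ℕ) (k : Fin 3) : approx n (corner k) = Pi.single k 1 := by
  induction n with
  | zero =>
    ext i
    rw [approx, bary_corner, Pi.single_apply]
  | succ n ih =>
    rw [approx, digit_corner, expand_corner, ih, extMatrix_mulVec_single]
    ext i
    simp [extMatrix, Pi.single_apply]

theorem sum_approx (n : ℕ) (x : EuclideanSpace ℝ (Fin 2)) : ∑ k, approx n x k = 1 := by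
  induction n generalizing x with
  | zero => rw [Fin.sum_univ_three]; exact bary_sum x
  | succ n ih => rw [approx, sum_extMatrix_mulVec, ih]

theorem approx_succ {x : EuclideanSpace ℝ (Fin 2)} (hx : ∀ k, 0 ≤ bary x k) {i : Fin 3}
    (hi : 1 / 2 ≤ bary x i) (n : ℕ) :
    approx (n + 1) x = (extMatrix i).mulVec (approx n (expand i x)) := by
  rw [approx]
  have hd := half_le_bary_digit ⟨i, hi⟩
  rcases eq_or_ne (digit x) i with h | h
  · rw [h]
  · rw [expand_eq_corner hx h hd hi, expand_eq_corner hx h.symm hi hd, approx_corner,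
      approx_corner, extMatrix_mulVec_single, extMatrix_mulVec_single]
    ext k
    exact extMatrix_comm _ _ _

theorem continuousOn_approx (n : ℕ) : ContinuousOn (approx n) gasket := by
  induction n with
  | zero => exact continuous_bary.continuousOn
  | succ n ih =>
    have hcover : gasket = ⋃ i, gasket ∩ {x | 1 / 2 ≤ bary x i} := by
      ext x
      simp only [Set.mem_iUnion, Set.mem_inter_iff, Set.mem_ofPred_eq, exists_and_left]
      exact ⟨fun hx => ⟨hx, exists_half_le_bary hx⟩, fun h => h.1⟩
    rw [hcover]
    refine LocallyFinite.continuousOn_iUnion (locallyFinite_of_finite _) (fun i => ?_) fun i => ?_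
    · refine isClosed_closure.inter (isClosed_le continuous_const ?_)
      fun_prop
    · have h1 : ContinuousOn (fun x => (extMatrix i).mulVec (approx n (expand i x)))
          (gasket ∩ {x | 1 / 2 ≤ bary x i}) := by
        have h2 : ContinuousOn (fun x => approx n (expand i x))
            (gasket ∩ {x | 1 / 2 ≤ bary x i}) :=
          ih.comp (continuous_expand i).continuousOn fun x hx => expand_mem_gasket hx.1 hx.2
        exact (Continuous.matrix_mulVec continuous_const continuous_id).comp_continuousOn h2
      exact h1.congr fun x hx => approx_succ (bary_nonneg_of_mem_gasket hx.1) hx.2 n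

theorem norm_approx_succ_sub_le (n : ℕ) {x : EuclideanSpace ℝ (Fin 2)} (hx : x ∈ gasket) :
    ‖approx (n + 1) x - approx n x‖ ≤ 2 * (3 / 5) ^ n := by
  induction n generalizing x with
  | zero =>
    have hle : ∀ {y : Fin 3 → ℝ}, (∀ k, 0 ≤ y k) → ∑ k, y k = 1 → ‖y‖ ≤ 1 := by
      intro y h0 hs
      refine (pi_norm_le_iff_of_nonneg zero_le_one).2 fun i => ?_
      rw [Real.norm_of_nonneg (h0 i), ← hs]
      exact Finset.single_le_sum (fun k _ => h0 k) (Finset.mem_univ i)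
    have h0 : ‖approx 0 x‖ ≤ 1 := hle (bary_nonneg_of_mem_gasket hx) (sum_approx 0 x)
    have h1 : ‖approx 1 x‖ ≤ 1 := by
      refine hle (fun k => ?_) (sum_approx 1 x)
      have hd := half_le_bary_digit (exists_half_le_bary hx)
      change 0 ≤ ∑ m, extMatrix (digit x) k m * approx 0 (expand (digit x) x) m
      refine Finset.sum_nonneg fun m _ => mul_nonneg ?_ ?_
      · rw [extMatrix, Matrix.of_apply]
        split_ifs <;> norm_num
      · exact bary_nonneg_of_mem_gasket (expand_mem_gasket hx hd) m
    refine (norm_sub_le _ _).trans ?_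
    simp only [pow_zero]
    linarith
  | succ n ih =>
    change ‖(extMatrix (digit x)).mulVec (approx (n + 1) (expand (digit x) x)) -
      (extMatrix (digit x)).mulVec (approx n (expand (digit x) x))‖ ≤ _
    rw [← Matrix.mulVec_sub]
    have hd := half_le_bary_digit (exists_half_le_bary hx)
    refine (norm_extMatrix_mulVec_le _ ?_).trans ?_
    · simp only [Pi.sub_apply, Finset.sum_sub_distrib]
      rw [sum_approx, sum_approx, sub_self]
    · have h := ih (expand_mem_gasket hx hd)
      rw [pow_succ]
      linarith

/-- The limit of the interpolations: its components are the harmonic coordinates. -/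
def harmonicLimit (x : EuclideanSpace ℝ (Fin 2)) : Fin 3 → ℝ :=
  approx 0 x + ∑' n, (approx (n + 1) x - approx n x)

theorem summable_geometric_three_fifths : Summable fun n : ℕ => 2 * (3 / 5 : ℝ) ^ n :=
  (summable_geometric_of_lt_one (by norm_num) (by norm_num)).mul_left _

theorem continuousOn_harmonicLimit : ContinuousOn harmonicLimit gasket :=
  (continuousOn_approx 0).add (continuousOn_tsum
    (fun n => (continuousOn_approx (n + 1)).sub (continuousOn_approx n))
    summable_geometric_three_fifths fun n _ hx => norm_approx_succ_sub_le n hx)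

theorem tendsto_approx {x : EuclideanSpace ℝ (Fin 2)} (hx : x ∈ gasket) :
    Filter.Tendsto (fun n => approx n x) Filter.atTop (nhds (harmonicLimit x)) := by
  have hs : Summable fun n => approx (n + 1) x - approx n x :=
    .of_norm_bounded summable_geometric_three_fifths fun n => norm_approx_succ_sub_le n hx
  have h := (hs.hasSum.tendsto_sum_nat).const_add (approx 0 x)
  refine h.congr fun n => ?_
  rw [Finset.sum_range_sub (fun n => approx n x)]
  abel

theorem harmonicLimit_corner (k : Fin 3) : harmonicLimit (corner k) = Pi.single k 1 := by
  refine tendsto_nhds_unique (tendsto_approx (corner_mem_gasket k)) ?_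
  simp_rw [approx_corner]
  exact tendsto_const_nhds

theorem harmonicLimit_contr (i : Fin 3) {x : EuclideanSpace ℝ (Fin 2)} (hx : x ∈ gasket) :
    harmonicLimit (contr i x) = (extMatrix i).mulVec (harmonicLimit x) := by
  have h1 := (tendsto_approx (contr_mem_gasket i hx)).comp (Filter.tendsto_add_atTop_nat 1)
  have h2 : Filter.Tendsto (fun n => (extMatrix i).mulVec (approx n x)) Filter.atTop
      (nhds ((extMatrix i).mulVec (harmonicLimit x))) :=
    ((Continuous.matrix_mulVec continuous_const continuous_id).tendsto _).comp (tendsto_approx hx)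
  refine tendsto_nhds_unique h1 (h2.congr fun n => ?_)
  have hi : 1 / 2 ≤ bary (contr i x) i := by
    rw [bary_contr, if_pos rfl]
    have := bary_nonneg_of_mem_gasket hx i
    linarith
  rw [Function.comp_apply, approx_succ (bary_nonneg_of_mem_gasket (contr_mem_gasket i hx)) hi,
    expand_contr]

/-- The harmonic extension rule: the values of `f` at the vertices of a cell determine, through
the extension matrices, those at the vertices of its subcells. -/
def HarmonicAt (f : EuclideanSpace ℝ (Fin 2) → ℝ) (w : List (Fin 3)) : Prop :=
  ∀ i k, f (contrWord (i :: w) (corner k)) =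
    ∑ m, extMatrix i m k * f (contrWord w (corner m))

theorem exists_harmonicLimit_contrWord (w : List (Fin 3)) :
    ∃ P : Matrix (Fin 3) (Fin 3) ℝ, ∀ x ∈ gasket, contrWord w x ∈ gasket ∧
      harmonicLimit (contrWord w x) = P.mulVec (harmonicLimit x) := by
  induction w with
  | nil => exact ⟨1, fun x hx => ⟨hx, (Matrix.one_mulVec _).symm⟩⟩
  | cons j w ih =>
    obtain ⟨P, hP⟩ := ih
    refine ⟨P * extMatrix j, fun x hx => ?_⟩
    have h := hP _ (contr_mem_gasket j hx)
    refine ⟨h.1, ?_⟩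
    rw [contrWord_cons, h.2, harmonicLimit_contr j hx, Matrix.mulVec_mulVec]

theorem harmonicAt_harmonicLimit (j : Fin 3) (w : List (Fin 3)) :
    HarmonicAt (fun x => harmonicLimit x j) w := by
  intro i k
  obtain ⟨P, hP⟩ := exists_harmonicLimit_contrWord w
  have hcol : ∀ m, harmonicLimit (contrWord w (corner m)) j = P j m := by
    intro m
    rw [(hP _ (corner_mem_gasket m)).2, harmonicLimit_corner]
    simp
  have h := (hP _ (contr_mem_gasket i (corner_mem_gasket k))).2
  simp only [contrWord_cons, hcol]
  rw [h, harmonicLimit_contr i (corner_mem_gasket k), harmonicLimit_corner,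
    extMatrix_mulVec_single]
  simp only [Matrix.mulVec, dotProduct]
  exact Finset.sum_congr rfl fun m _ => mul_comm _ _

/-! ### Energy -/

/-- The energy of `f` on the cell of the word `w`. -/
def cellEnergy (f : EuclideanSpace ℝ (Fin 2) → ℝ) (w : List (Fin 3)) : ℝ :=
  ∑ i : Fin 3, (f (contrWord w (corner i)) - f (contrWord w (corner (i + 1)))) ^ 2

/-- The deviation of `f` from the harmonic extension rule at the midpoint opposite to `i`. -/
def defect (f : EuclideanSpace ℝ (Fin 2) → ℝ) (w : List (Fin 3)) (i : Fin 3) : ℝ :=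
  f (contrWord ((i + 1) :: w) (corner (i + 2))) -
    ∑ m, extMatrix (i + 1) m (i + 2) * f (contrWord w (corner m))

theorem harmonicAt_iff_defect {f : EuclideanSpace ℝ (Fin 2) → ℝ} {w : List (Fin 3)} :
    HarmonicAt f w ↔ ∀ i, defect f w i = 0 := by
  constructor
  · intro h i
    rw [defect, h, sub_self]
  · intro h
    have h' : ∀ i, f (contrWord ((i + 1) :: w) (corner (i + 2))) =
        ∑ m, extMatrix (i + 1) m (i + 2) * f (contrWord w (corner m)) :=
      fun i => sub_eq_zero.1 (h i)
    intro i k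
    by_cases hki : k = i
    · subst hki
      rw [contrWord_cons, contr_corner_self]
      simp [extMatrix]
    · have hcomm : f (contrWord (i :: w) (corner k)) = f (contrWord (k :: w) (corner i)) := by
        rw [contrWord_cons, contrWord_cons, contr_corner_comm]
      have hcases : (∃ l : Fin 3, i = l + 1 ∧ k = l + 2) ∨ ∃ l : Fin 3, k = l + 1 ∧ i = l + 2 := by
        revert hki
        clear hcomm
        revert i k
        decide
      rcases hcases with ⟨l, rfl, rfl⟩ | ⟨l, rfl, rfl⟩
      · exact h' l
      · rw [hcomm, h' l]
        exact Finset.sum_congr rfl fun m _ => by rw [extMatrix_comm]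

theorem sum_cellEnergy_cons (f : EuclideanSpace ℝ (Fin 2) → ℝ) (w : List (Fin 3)) :
    ∑ j, cellEnergy f (j :: w) = 3 / 5 * cellEnergy f w +
      (2 * ∑ i, defect f w i ^ 2 + ∑ i, (defect f w i - defect f w (i + 1)) ^ 2) := by
  have e1 : contr 1 (corner 0) = contr 0 (corner 1) := contr_corner_comm 1 0
  have e2 : contr 2 (corner 0) = contr 0 (corner 2) := contr_corner_comm 2 0
  have e3 : contr 2 (corner 1) = contr 1 (corner 2) := contr_corner_comm 2 1
  have d00 : (0 : Fin 3) + 1 = 1 := rfl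
  have d01 : (1 : Fin 3) + 1 = 2 := rfl
  have d02 : (2 : Fin 3) + 1 = 0 := rfl
  have d10 : (0 : Fin 3) + 2 = 2 := rfl
  have d11 : (1 : Fin 3) + 2 = 0 := rfl
  have d12 : (2 : Fin 3) + 2 = 1 := rfl
  simp only [cellEnergy, defect, Fin.sum_univ_three, contrWord_cons, d00, d01, d02, d10, d11, d12,
    contr_corner_self, e1, e2, e3]
  simp [extMatrix]
  ring

theorem energy_succ (n : ℕ) (f : EuclideanSpace ℝ (Fin 2) → ℝ) :
    energy (n + 1) f = 3 / 5 * energy n f + ∑ w : Fin n → Fin 3,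
      (2 * ∑ i, defect f (List.ofFn w) i ^ 2 +
        ∑ i, (defect f (List.ofFn w) i - defect f (List.ofFn w) (i + 1)) ^ 2) := by
  have h1 : energy (n + 1) f = ∑ w : Fin n → Fin 3, ∑ j, cellEnergy f (j :: List.ofFn w) := by
    unfold energy
    rw [← (Fin.consEquiv fun _ : Fin (n + 1) => Fin 3).sum_comp, Fintype.sum_prod_type,
      Finset.sum_comm]
    refine Finset.sum_congr rfl fun w _ => Finset.sum_congr rfl fun j _ => ?_
    have h2 : List.ofFn (Fin.consEquiv (fun _ : Fin (n + 1) => Fin 3) (j, w)) =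
        j :: List.ofFn w := by
      simp [List.ofFn_succ]
    rw [h2]
    rfl
  rw [h1]
  simp_rw [sum_cellEnergy_cons]
  rw [Finset.sum_add_distrib, ← Finset.mul_sum]
  rfl

theorem le_energy (n : ℕ) (f : EuclideanSpace ℝ (Fin 2) → ℝ) :
    (3 / 5) ^ n * energy 0 f ≤ energy n f := by
  induction n with
  | zero => simp
  | succ n ih =>
    rw [energy_succ, pow_succ]
    have h : 0 ≤ ∑ w : Fin n → Fin 3, (2 * ∑ i, defect f (List.ofFn w) i ^ 2 +
        ∑ i, (defect f (List.ofFn w) i - defect f (List.ofFn w) (i + 1)) ^ 2) :=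
      Finset.sum_nonneg fun w _ => by positivity
    linarith

theorem energy_of_harmonicAt {f : EuclideanSpace ℝ (Fin 2) → ℝ} (hf : ∀ w, HarmonicAt f w)
    (n : ℕ) : energy n f = (3 / 5) ^ n * energy 0 f := by
  induction n with
  | zero => simp
  | succ n ih =>
    rw [energy_succ, ih, pow_succ]
    have h : ∀ w i, defect f w i = 0 := fun w => harmonicAt_iff_defect.1 (hf w)
    simp [h]
    ring

theorem energy_zero_congr {f g : EuclideanSpace ℝ (Fin 2) → ℝ}
    (h : ∀ k, f (corner k) = g (corner k)) : energy 0 f = energy 0 g := by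
  simp [energy, contrWord, h]

theorem isHarmonicCoord_harmonicLimit (j : Fin 3) :
    IsHarmonicCoord j fun x => harmonicLimit x j where
  boundary k := by
    rw [harmonicLimit_corner, Pi.single_apply]
    simp only [eq_comm]
  minimizes n g hg := by
    rw [energy_of_harmonicAt (harmonicAt_harmonicLimit j), ← energy_zero_congr hg]
    exact le_energy n g
  continuousOn := (continuous_apply j).comp_continuousOn continuousOn_harmonicLimit

theorem isHarmonicCoord_harmonicCoord (j : Fin 3) : IsHarmonicCoord j (harmonicCoord j) :=
  Classical.epsilon_spec ⟨_, isHarmonicCoord_harmonicLimit j⟩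

theorem IsHarmonicCoord.harmonicAt {j : Fin 3} {f : EuclideanSpace ℝ (Fin 2) → ℝ}
    (hf : IsHarmonicCoord j f) (w : List (Fin 3)) : HarmonicAt f w := by
  have hE : ∀ n, energy n f = (3 / 5) ^ n * energy 0 f := by
    intro n
    have hb : ∀ k, harmonicLimit (corner k) j = f (corner k) := fun k => by
      rw [hf.boundary k]
      exact (isHarmonicCoord_harmonicLimit j).boundary k
    refine le_antisymm ((hf.minimizes n (fun x => harmonicLimit x j) hb).trans_eq ?_) (le_energy n f)
    rw [energy_of_harmonicAt (harmonicAt_harmonicLimit j), energy_zero_congr hb]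
  have h := energy_succ w.length f
  rw [hE (w.length + 1), hE w.length, pow_succ] at h
  have h0 : ∑ v : Fin w.length → Fin 3, (2 * ∑ i, defect f (List.ofFn v) i ^ 2 +
      ∑ i, (defect f (List.ofFn v) i - defect f (List.ofFn v) (i + 1)) ^ 2) = 0 := by
    linarith
  have h1 := (Finset.sum_eq_zero_iff_of_nonneg fun v _ => by positivity).1 h0 w.get
    (Finset.mem_univ _)
  rw [List.ofFn_get] at h1
  have h2 : ∑ i, defect f w i ^ 2 = 0 := by
    have h3 : 0 ≤ ∑ i, defect f w i ^ 2 := by positivity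
    have h4 : 0 ≤ ∑ i, (defect f w i - defect f w (i + 1)) ^ 2 := by positivity
    linarith
  rw [harmonicAt_iff_defect]
  intro i
  exact pow_eq_zero_iff (two_ne_zero) |>.1
    ((Finset.sum_eq_zero_iff_of_nonneg fun i _ => sq_nonneg _).1 h2 i (Finset.mem_univ i))

/-! ### Variation along the edges -/

/-- The variation of a continuous function on `[0, 1]` is controlled by the dyadic subdivisions. -/
theorem eVariationOn_Icc_le_of_dyadic {E : Type*} [PseudoEMetricSpace E] {g : ℝ → E}
    (hg : ContinuousOn g (Set.Icc 0 1)) {M : ENNReal}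
    (h : ∀ n : ℕ, ∑ k ∈ Finset.range (2 ^ n),
      edist (g ((k : ℝ) / 2 ^ n)) (g (((k + 1 : ℕ) : ℝ) / 2 ^ n)) ≤ M) :
    eVariationOn g (Set.Icc 0 1) ≤ M := by
  by_contra! hlt
  have hpow : Filter.Tendsto (fun n : ℕ => (2 : ℝ) ^ n) Filter.atTop Filter.atTop :=
    tendsto_pow_atTop_atTop_of_one_lt one_lt_two
  have hlim : ∀ t ∈ Set.Icc (0 : ℝ) 1, Filter.Tendsto
      (fun n : ℕ => g ((⌊t * 2 ^ n⌋₊ : ℝ) / 2 ^ n)) Filter.atTop (nhds (g t)) := by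
    intro t ht
    refine (hg t ht).tendsto.comp (tendsto_nhdsWithin_iff.2
      ⟨(tendsto_nat_floor_mul_div_atTop ht.1).comp hpow, Filter.Eventually.of_forall fun n => ?_⟩)
    have h2 : (0 : ℝ) < 2 ^ n := by positivity
    refine ⟨by positivity, (div_le_one h2).2 ?_⟩
    refine (Nat.floor_le (mul_nonneg ht.1 h2.le)).trans ?_
    exact mul_le_of_le_one_left h2.le ht.2
  obtain ⟨n, hn⟩ := (eVariationOn.lowerSemicontinuous_aux hlim hlt).exists
  refine absurd hn (not_lt.2 ?_)
  refine iSup_le ?_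
  rintro ⟨N, u, hu, hu01⟩
  have hm : Monotone fun i => ⌊u i * 2 ^ n⌋₊ := fun i j hij =>
    Nat.floor_mono (mul_le_mul_of_nonneg_right (hu hij) (by positivity))
  have hsum : ∀ N, ∑ i ∈ Finset.range N,
      edist (g ((⌊u (i + 1) * 2 ^ n⌋₊ : ℝ) / 2 ^ n)) (g ((⌊u i * 2 ^ n⌋₊ : ℝ) / 2 ^ n)) ≤
        ∑ k ∈ Finset.Ico ⌊u 0 * 2 ^ n⌋₊ ⌊u N * 2 ^ n⌋₊,
          edist (g ((k : ℝ) / 2 ^ n)) (g (((k + 1 : ℕ) : ℝ) / 2 ^ n)) := by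
    intro N
    induction N with
    | zero => simp
    | succ N ih =>
      rw [Finset.sum_range_succ, ← Finset.sum_Ico_consecutive _ (hm (Nat.zero_le N))
        (hm (Nat.le_succ N)), edist_comm]
      exact add_le_add ih (edist_le_Ico_sum_edist (fun k : ℕ => g ((k : ℝ) / 2 ^ n))
        (hm (Nat.le_succ N)))
  refine (hsum N).trans (le_trans (Finset.sum_le_sum_of_subset ?_) (h n))
  intro k hk
  rw [Finset.mem_Ico] at hk
  rw [Finset.mem_range]
  refine hk.2.trans_le ?_
  have h1 : ⌊u N * 2 ^ n⌋₊ ≤ ⌊((2 ^ n : ℕ) : ℝ)⌋₊ := by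
    refine Nat.floor_mono ?_
    push_cast
    exact mul_le_of_le_one_left (by positivity) (hu01 N).2
  rwa [Nat.floor_natCast] at h1

theorem sum_fin_three_add (i : Fin 3) (g : Fin 3 → ℝ) :
    ∑ m, g m = g i + g (i + 1) + g (i + 2) := by
  rw [Fin.sum_univ_three]
  fin_cases i
  · rfl
  · change _ = g 1 + g 2 + g 0
    ring
  · change _ = g 2 + g 0 + g 1
    ring

theorem extMatrix_apply_add (i : Fin 3) : extMatrix i i (i + 1) = 2 / 5 ∧
    extMatrix i (i + 1) (i + 1) = 2 / 5 ∧ extMatrix i (i + 2) (i + 1) = 1 / 5 ∧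
    extMatrix i i (i + 2) = 2 / 5 ∧ extMatrix i (i + 1) (i + 2) = 1 / 5 ∧
    extMatrix i (i + 2) (i + 2) = 2 / 5 := by
  fin_cases i <;> simp [extMatrix]

section Harmonic

variable {f : EuclideanSpace ℝ (Fin 2) → ℝ} {w : List (Fin 3)}

theorem apply_cons_corner_self (f : EuclideanSpace ℝ (Fin 2) → ℝ) (w : List (Fin 3)) (i : Fin 3) :
    f (contrWord (i :: w) (corner i)) = f (contrWord w (corner i)) := by
  rw [contrWord_cons, contr_corner_self]

theorem HarmonicAt.apply_add_one (h : HarmonicAt f w) (i : Fin 3) :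
    f (contrWord (i :: w) (corner (i + 1))) = (2 * f (contrWord w (corner i)) +
      2 * f (contrWord w (corner (i + 1))) + f (contrWord w (corner (i + 2)))) / 5 := by
  obtain ⟨h1, h2, h3, -⟩ := extMatrix_apply_add i
  rw [h i (i + 1), sum_fin_three_add i, h1, h2, h3]
  ring

theorem HarmonicAt.apply_add_two (h : HarmonicAt f w) (i : Fin 3) :
    f (contrWord (i :: w) (corner (i + 2))) = (2 * f (contrWord w (corner i)) +
      f (contrWord w (corner (i + 1))) + 2 * f (contrWord w (corner (i + 2)))) / 5 := by
  obtain ⟨-, -, -, h1, h2, h3⟩ := extMatrix_apply_add i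
  rw [h i (i + 2), sum_fin_three_add i, h1, h2, h3]
  ring

/-- A bound for the variation of a harmonic function along the edge `i` of the cell `w`. -/
def edgeFlux (f : EuclideanSpace ℝ (Fin 2) → ℝ) (w : List (Fin 3)) (i : Fin 3) : ℝ :=
  max |f (contrWord w (corner (i + 1))) - f (contrWord w (corner i))|
    |2 * f (contrWord w (corner (i + 2))) - f (contrWord w (corner i)) -
      f (contrWord w (corner (i + 1)))|

theorem HarmonicAt.edgeFlux_add_le (h : HarmonicAt f w) (i : Fin 3) :
    edgeFlux f (i :: w) i + edgeFlux f ((i + 1) :: w) i ≤ edgeFlux f w i := by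
  have e1 : i + 1 + 1 = i + 2 := by rw [add_assoc]; rfl
  have e2 : i + 1 + 2 = i := by rw [add_assoc]; exact add_zero i
  have h1 := apply_cons_corner_self f w i
  have h2 := h.apply_add_one i
  have h3 := h.apply_add_two i
  have h4 := apply_cons_corner_self f w (i + 1)
  have h5 := h.apply_add_one (i + 1)
  have h6 := h.apply_add_two (i + 1)
  rw [e1, e2] at h5 h6
  unfold edgeFlux
  rw [h1, h2, h3, h4, h5, h6]
  generalize f (contrWord w (corner i)) = a
  generalize f (contrWord w (corner (i + 1))) = b
  generalize f (contrWord w (corner (i + 2))) = c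
  obtain ⟨M, hM⟩ : ∃ M, M = max |b - a| |2 * c - a - b| := ⟨_, rfl⟩
  have hu : |b - a| ≤ M := hM ▸ le_max_left _ _
  have hv : |2 * c - a - b| ≤ M := hM ▸ le_max_right _ _
  rw [← hM]
  rw [abs_le] at hu hv
  obtain ⟨hu1, hu2⟩ := hu
  obtain ⟨hv1, hv2⟩ := hv
  clear hM
  rw [← le_sub_iff_add_le]
  refine max_le (abs_le'.2 ⟨?_, ?_⟩) (abs_le'.2 ⟨?_, ?_⟩) <;> rw [le_sub_comm] <;>
    refine max_le (abs_le'.2 ⟨?_, ?_⟩) (abs_le'.2 ⟨?_, ?_⟩) <;> linarith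

theorem contrWord_lineMap_left (w : List (Fin 3)) (i : Fin 3) (t : ℝ) :
    contrWord w (AffineMap.lineMap (corner i) (corner (i + 1)) (t / 2)) =
      contrWord (i :: w) (AffineMap.lineMap (corner i) (corner (i + 1)) t) := by
  rw [contrWord_cons]
  congr 1
  ext k
  simp [contr, AffineMap.lineMap_apply]
  ring

theorem contrWord_lineMap_right (w : List (Fin 3)) (i : Fin 3) (t : ℝ) :
    contrWord w (AffineMap.lineMap (corner i) (corner (i + 1)) ((1 + t) / 2)) =
      contrWord ((i + 1) :: w) (AffineMap.lineMap (corner i) (corner (i + 1)) t) := by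
  rw [contrWord_cons]
  congr 1
  ext k
  simp [contr, AffineMap.lineMap_apply]
  ring

theorem sum_dyadic_le_edgeFlux (hf : ∀ w, HarmonicAt f w) (n : ℕ) (w : List (Fin 3))
    (i : Fin 3) :
    ∑ k ∈ Finset.range (2 ^ n),
      |f (contrWord w (AffineMap.lineMap (corner i) (corner (i + 1)) ((k : ℝ) / 2 ^ n))) -
        f (contrWord w (AffineMap.lineMap (corner i) (corner (i + 1))
          (((k + 1 : ℕ) : ℝ) / 2 ^ n)))| ≤ edgeFlux f w i := by
  induction n generalizing w with
  | zero =>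
    simp only [pow_zero, Finset.range_one, Finset.sum_singleton, Nat.cast_zero,
      AffineMap.lineMap_apply_zero, zero_add, Nat.cast_one, div_one, AffineMap.lineMap_apply_one]
    rw [abs_sub_comm]
    exact le_max_left _ _
  | succ n ih =>
    refine le_trans (le_of_eq ?_) ((add_le_add (ih (i :: w)) (ih ((i + 1) :: w))).trans
      ((hf w).edgeFlux_add_le i))
    rw [pow_succ, mul_two, Finset.sum_range_add]
    have hl : ∀ k : ℕ, (k : ℝ) / 2 ^ (n + 1) = (k : ℝ) / 2 ^ n / 2 := fun k => by
      rw [pow_succ, div_div]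
    have hr : ∀ k : ℕ, ((2 ^ n + k : ℕ) : ℝ) / 2 ^ (n + 1) = (1 + (k : ℝ) / 2 ^ n) / 2 := by
      intro k
      push_cast
      field_simp
      ring
    congr 1
    · refine Finset.sum_congr rfl fun k _ => ?_
      rw [hl, hl, contrWord_lineMap_left, contrWord_lineMap_left]
    · refine Finset.sum_congr rfl fun k _ => ?_
      rw [add_assoc, hr, hr, contrWord_lineMap_right, contrWord_lineMap_right]

theorem abs_sub_le_of_harmonicAt (hf : ∀ w, HarmonicAt f w) {C : ℝ}
    (hC : ∀ k l, |f (corner k) - f (corner l)| ≤ C) (w : List (Fin 3)) (k l : Fin 3) :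
    |f (contrWord w (corner k)) - f (contrWord w (corner l))| ≤ C * (3 / 5) ^ w.length := by
  induction w generalizing k l with
  | nil => simpa [contrWord] using hC k l
  | cons i w ih =>
    have h1 := apply_cons_corner_self f w i
    have h2 := (hf w).apply_add_one i
    have h3 := (hf w).apply_add_two i
    have a1 := abs_le.1 (ih i (i + 1))
    have a2 := abs_le.1 (ih i (i + 2))
    have a3 := abs_le.1 (ih (i + 1) (i + 2))
    have hcases : ∀ m : Fin 3, m = i ∨ m = i + 1 ∨ m = i + 2 := by
      clear h1 h2 h3 a1 a2 a3 ih
      revert i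
      decide
    rw [List.length_cons, pow_succ, abs_le]
    rcases hcases k with hk | hk | hk <;> rcases hcases l with hl | hl | hl <;>
      rw [hk, hl] <;> constructor <;> linarith

theorem edgeFlux_le_of_harmonicAt (hf : ∀ w, HarmonicAt f w) {C : ℝ}
    (hC : ∀ k l, |f (corner k) - f (corner l)| ≤ C) (w : List (Fin 3)) (i : Fin 3) :
    edgeFlux f w i ≤ 2 * C * (3 / 5) ^ w.length := by
  have a1 := abs_le.1 (abs_sub_le_of_harmonicAt hf hC w i (i + 1))
  have a2 := abs_le.1 (abs_sub_le_of_harmonicAt hf hC w i (i + 2))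
  have a3 := abs_le.1 (abs_sub_le_of_harmonicAt hf hC w (i + 1) (i + 2))
  refine max_le (abs_le.2 ⟨?_, ?_⟩) (abs_le.2 ⟨?_, ?_⟩) <;> linarith

end Harmonic

/-! ### The lengths of the edge curves -/

theorem harmonicAt_harmonicCoord (j : Fin 3) (w : List (Fin 3)) :
    HarmonicAt (harmonicCoord j) w :=
  (isHarmonicCoord_harmonicCoord j).harmonicAt w

theorem continuousOn_harmonicMap : ContinuousOn harmonicMap gasket := by
  unfold harmonicMap
  refine (PiLp.continuous_toLp 2 _).comp_continuousOn (continuousOn_pi.2 fun j => ?_)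
  exact ((isHarmonicCoord_harmonicCoord j).continuousOn.sub continuousOn_const).const_smul
    (1 / Real.sqrt 2)

theorem edist_harmonicMap_le (x y : EuclideanSpace ℝ (Fin 2)) :
    edist (harmonicMap x) (harmonicMap y) ≤
      ENNReal.ofReal (∑ j, |harmonicCoord j x - harmonicCoord j y|) := by
  rw [edist_dist]
  refine ENNReal.ofReal_le_ofReal ?_
  rw [EuclideanSpace.dist_eq]
  have hnn : 0 ≤ ∑ j, |harmonicCoord j x - harmonicCoord j y| :=
    Finset.sum_nonneg fun j _ => abs_nonneg _
  rw [← Real.sqrt_sq hnn]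
  refine Real.sqrt_le_sqrt ?_
  refine le_trans ?_ (Finset.sum_sq_le_sq_sum_of_nonneg fun j _ => abs_nonneg _)
  refine Finset.sum_le_sum fun j _ => ?_
  have h2 : |1 / Real.sqrt 2| ≤ 1 := by
    rw [abs_of_nonneg (by positivity), div_le_one (by positivity), Real.one_le_sqrt]
    norm_num
  have h1 : dist (harmonicMap x j) (harmonicMap y j) =
      |1 / Real.sqrt 2| * |harmonicCoord j x - harmonicCoord j y| := by
    rw [Real.dist_eq, ← abs_mul]
    congr 1
    simp only [harmonicMap]
    ring
  rw [h1]
  gcongr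
  exact mul_le_of_le_one_left (abs_nonneg _) h2

theorem edgeLength_le_eVariationOn (e : Edge) :
    edgeLength e ≤ eVariationOn (fun t => harmonicMap (contrWord e.1
      (AffineMap.lineMap (corner e.2) (corner (e.2 + 1)) t))) (Set.Icc (0 : ℝ) 1) := by
  have hpos : (0 : ℝ) < 2 ^ e.1.length := by positivity
  have h : edgeLength e = eVariationOn ((fun t => harmonicMap (contrWord e.1
      (AffineMap.lineMap (corner e.2) (corner (e.2 + 1)) t))) ∘
        fun t => (2 : ℝ) ^ e.1.length * t) (Set.Icc 0 ((2 : ℝ) ^ e.1.length)⁻¹) := by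
    unfold edgeLength edgeCurve
    simp only [Function.comp_def, contrWord_lineMap]
  rw [h]
  refine eVariationOn.comp_le_of_monotoneOn _ _ ?_ ?_
  · exact fun s _ t _ hst => mul_le_mul_of_nonneg_left hst hpos.le
  · intro t ht
    refine ⟨mul_nonneg hpos.le ht.1, ?_⟩
    calc (2 : ℝ) ^ e.1.length * t ≤ 2 ^ e.1.length * (2 ^ e.1.length)⁻¹ := by
          gcongr
          exact ht.2
      _ = 1 := mul_inv_cancel₀ hpos.ne'

theorem abs_harmonicCoord_corner_sub_le (j k l : Fin 3) :
    |harmonicCoord j (corner k) - harmonicCoord j (corner l)| ≤ 1 := by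
  rw [(isHarmonicCoord_harmonicCoord j).boundary, (isHarmonicCoord_harmonicCoord j).boundary]
  split_ifs <;> norm_num

theorem edgeLength_le (e : Edge) :
    edgeLength e ≤ ENNReal.ofReal (6 * (3 / 5) ^ e.1.length) := by
  obtain ⟨w, i⟩ := e
  refine (edgeLength_le_eVariationOn _).trans (eVariationOn_Icc_le_of_dyadic ?_ fun n => ?_)
  · refine continuousOn_harmonicMap.comp ?_ fun t ht =>
      contrWord_mem_gasket (lineMap_mem_triangle i ht) w
    have h : (fun t : ℝ => contrWord w (AffineMap.lineMap (corner i) (corner (i + 1)) t)) =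
        fun t : ℝ => AffineMap.lineMap (contrWord w (corner i)) (contrWord w (corner (i + 1))) t :=
      funext fun t => contrWord_lineMap w _ _ t
    change ContinuousOn
      (fun t : ℝ => contrWord w (AffineMap.lineMap (corner i) (corner (i + 1)) t)) _
    rw [h]
    exact AffineMap.lineMap_continuous.continuousOn
  · refine (Finset.sum_le_sum fun k _ => edist_harmonicMap_le _ _).trans ?_
    rw [← ENNReal.ofReal_sum_of_nonneg
      fun k _ => Finset.sum_nonneg fun j _ => abs_nonneg _]
    refine ENNReal.ofReal_le_ofReal ?_
    rw [Finset.sum_comm]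
    refine (Finset.sum_le_sum fun j _ =>
      (sum_dyadic_le_edgeFlux (harmonicAt_harmonicCoord j) n w i).trans
        (edgeFlux_le_of_harmonicAt (harmonicAt_harmonicCoord j)
          (abs_harmonicCoord_corner_sub_le j) w i)).trans ?_
    simp
    linarith

theorem det_harmonicCoord_ne_zero (w : List (Fin 3)) :
    (Matrix.of fun j k => harmonicCoord j (contrWord w (corner k))).det ≠ 0 := by
  induction w with
  | nil =>
    have h : (Matrix.of fun j k => harmonicCoord j (contrWord [] (corner k))) =
        (1 : Matrix (Fin 3) (Fin 3) ℝ) := by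
      ext j k
      rw [Matrix.of_apply, Matrix.one_apply]
      refine ((isHarmonicCoord_harmonicCoord j).boundary k).trans ?_
      simp only [eq_comm]
    rw [h, Matrix.det_one]
    exact one_ne_zero
  | cons i w ih =>
    have h : (Matrix.of fun j k => harmonicCoord j (contrWord (i :: w) (corner k))) =
        (Matrix.of fun j k => harmonicCoord j (contrWord w (corner k))) * extMatrix i := by
      ext j k
      rw [Matrix.of_apply, harmonicAt_harmonicCoord j w i k, Matrix.mul_apply]
      exact Finset.sum_congr rfl fun m _ => mul_comm _ _
    rw [h, Matrix.det_mul]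
    exact mul_ne_zero ih (det_extMatrix_ne_zero i)

theorem edgeLength_pos (e : Edge) : 0 < edgeLength e := by
  obtain ⟨w, i⟩ := e
  rw [pos_iff_ne_zero]
  intro h0
  have hpos : (0 : ℝ) < 2 ^ w.length := by positivity
  have h := eVariationOn.edist_le (fun t => harmonicMap (edgeCurve (w, i) t))
    (s := Set.Icc 0 ((2 : ℝ) ^ w.length)⁻¹) (x := 0) (y := ((2 : ℝ) ^ w.length)⁻¹)
    ⟨le_rfl, by positivity⟩ ⟨by positivity, le_rfl⟩
  have h1 : harmonicMap (edgeCurve (w, i) 0) =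
      harmonicMap (edgeCurve (w, i) ((2 : ℝ) ^ w.length)⁻¹) :=
    edist_le_zero.1 (h.trans_eq h0)
  simp only [edgeCurve, mul_zero, mul_inv_cancel₀ hpos.ne', AffineMap.lineMap_apply_zero,
    AffineMap.lineMap_apply_one] at h1
  refine det_harmonicCoord_ne_zero w (Matrix.det_zero_of_column_eq (i := i) (j := i + 1) ?_ ?_)
  · clear h0 h h1
    revert i
    decide
  · intro j
    have h2 := congrFun (congrArg WithLp.ofLp h1) j
    have h3 : (1 / Real.sqrt 2) ≠ 0 := by positivity
    have h4 := mul_left_cancel₀ h3 h2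
    rw [Matrix.of_apply, Matrix.of_apply]
    linarith

theorem edgeLength_ne_top (e : Edge) : edgeLength e ≠ ⊤ :=
  ((edgeLength_le e).trans_lt ENNReal.ofReal_lt_top).ne

theorem edgeLength_toReal_pos (e : Edge) : 0 < (edgeLength e).toReal :=
  ENNReal.toReal_pos (edgeLength_pos e).ne' (edgeLength_ne_top e)

/-! ### Summability of the lengths -/

theorem tsum_list_length (F : ℕ → ENNReal) :
    ∑' w : List (Fin 3), F w.length = ∑' n, 3 ^ n * F n := by
  rw [← List.equivSigmaTuple.symm.tsum_eq, ENNReal.tsum_sigma']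
  refine tsum_congr fun n => ?_
  have h : ∀ v : Fin n → Fin 3, F (List.equivSigmaTuple.symm ⟨n, v⟩).length = F n := by
    intro v
    change F (List.ofFn v).length = F n
    rw [List.length_ofFn]
  simp only [h]
  rw [tsum_fintype, Finset.sum_const, Finset.card_univ, Fintype.card_fun, Fintype.card_fin,
    Fintype.card_fin, nsmul_eq_mul]
  push_cast
  rfl

theorem log_five_sub_log_three_pos : 0 < Real.log 5 - Real.log 3 :=
  sub_pos.2 (Real.log_lt_log (by norm_num) (by norm_num))

theorem critical_exponent_pos : 0 < Real.log 3 / (Real.log 5 - Real.log 3) :=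
  div_pos (Real.log_pos (by norm_num)) log_five_sub_log_three_pos

theorem three_mul_rpow_lt_one {s : ℝ} (hs : Real.log 3 / (Real.log 5 - Real.log 3) < s) :
    3 * (3 / 5 : ℝ) ^ s < 1 := by
  rw [div_lt_iff₀ log_five_sub_log_three_pos] at hs
  have h : 3 * (3 / 5 : ℝ) ^ s = Real.exp (Real.log 3 + Real.log (3 / 5) * s) := by
    rw [Real.exp_add, Real.exp_log (by norm_num), Real.rpow_def_of_pos (by norm_num)]
  rw [h, ← Real.exp_zero, Real.exp_lt_exp, Real.log_div (by norm_num) (by norm_num)]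
  linarith

theorem tsum_edgeLength_rpow_lt_top {s : ℝ}
    (hs : Real.log 3 / (Real.log 5 - Real.log 3) < s) : ∑' e : Edge, edgeLength e ^ s < ⊤ := by
  have hs0 : 0 < s := critical_exponent_pos.trans hs
  have hterm : ∀ n : ℕ, 3 ^ n * ENNReal.ofReal (6 * (3 / 5) ^ n) ^ s =
      ENNReal.ofReal (6 ^ s * (3 * (3 / 5 : ℝ) ^ s) ^ n) := by
    intro n
    rw [ENNReal.ofReal_rpow_of_nonneg (by positivity) hs0.le,
      show (3 : ENNReal) = ENNReal.ofReal 3 by simp, ← ENNReal.ofReal_pow (by norm_num),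
      ← ENNReal.ofReal_mul (by positivity), Real.mul_rpow (by norm_num) (by positivity), mul_pow,
      ← Real.rpow_natCast (3 / 5), ← Real.rpow_natCast ((3 / 5) ^ s), ← Real.rpow_mul (by norm_num),
      ← Real.rpow_mul (by norm_num), mul_comm (n : ℝ) s]
    congr 1
    ring
  calc ∑' e : Edge, edgeLength e ^ s
      ≤ ∑' e : Edge, ENNReal.ofReal (6 * (3 / 5) ^ e.1.length) ^ s :=
        ENNReal.tsum_le_tsum fun e => ENNReal.rpow_le_rpow (edgeLength_le e) hs0.le
    _ = ∑' w : List (Fin 3), 3 * ENNReal.ofReal (6 * (3 / 5) ^ w.length) ^ s := by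
        rw [ENNReal.tsum_prod']
        simp [tsum_fintype]
    _ = 3 * ∑' n : ℕ, ENNReal.ofReal (6 ^ s * (3 * (3 / 5 : ℝ) ^ s) ^ n) := by
        rw [ENNReal.tsum_mul_left,
          tsum_list_length fun n => ENNReal.ofReal (6 * (3 / 5) ^ n) ^ s]
        simp only [hterm]
    _ < ⊤ := by
        refine ENNReal.mul_lt_top (by simp) (Summable.tsum_ofReal_lt_top ?_)
        exact (summable_geometric_of_lt_one (by positivity) (three_mul_rpow_lt_one hs)).mul_left _

/-! ### The spectral dimension -/

theorem exists_isDiagonal_gasketDirac :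
    ∃ B : HilbertBasis (Σ _ : Edge, ℤ) ℂ GasketSpace,
      IsDiagonal B (fun s => Real.pi * (2 * s.2 + 1) / (2 * (edgeLength s.1).toReal))
        gasketDirac := by
  choose b hb using fun e : Edge => exists_isDiagonal_curveDirac (edgeLength_toReal_pos e)
  obtain ⟨B, hB⟩ := exists_hilbertBasis_lp b
  exact ⟨B, IsDiagonal.directSumOp hb hB⟩

theorem spectralDim_gasketDirac :
    spectralDim gasketDirac = sInf {d | ∃ p : ℝ, 0 < p ∧ d = ENNReal.ofReal p ∧
      ∑' s : Σ _ : Edge, ℤ, ENNReal.ofReal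
        ((1 + (Real.pi * (2 * s.2 + 1) / (2 * (edgeLength s.1).toReal)) ^ 2) ^ (-(p / 2))) <
          ⊤} := by
  obtain ⟨B, hB⟩ := exists_isDiagonal_gasketDirac
  exact hB.spectralDim_eq

theorem rpow_eigenvalue_le {ℓ p : ℝ} (hℓ : 0 < ℓ) (hp : 0 < p) (k : ℤ) :
    (1 + (Real.pi * (2 * k + 1) / (2 * ℓ)) ^ 2) ^ (-(p / 2)) ≤
      ℓ ^ p * |((2 * k + 1 : ℤ) : ℝ)| ^ (-p) := by
  have hk : ((2 * k + 1 : ℤ) : ℝ) ≠ 0 := by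
    have : 2 * k + 1 ≠ 0 := by omega
    exact_mod_cast this
  set m : ℝ := ((2 * k + 1 : ℤ) : ℝ) with hm
  have hm' : (2 * k + 1 : ℝ) = m := by rw [hm]; push_cast; rfl
  have hq : 0 < |m| / ℓ := div_pos (abs_pos.2 hk) hℓ
  have h1 : (|m| / ℓ) ^ 2 ≤ 1 + (Real.pi * (2 * k + 1) / (2 * ℓ)) ^ 2 := by
    have h2 : (Real.pi * (2 * k + 1) / (2 * ℓ)) ^ 2 = (Real.pi / 2) ^ 2 * (|m| / ℓ) ^ 2 := by
      rw [hm', div_pow |m|, sq_abs]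
      field_simp
    have h3 : (1 : ℝ) ≤ (Real.pi / 2) ^ 2 := one_le_pow₀ (by linarith [Real.two_le_pi])
    rw [h2]
    nlinarith [sq_nonneg (|m| / ℓ)]
  calc (1 + (Real.pi * (2 * k + 1) / (2 * ℓ)) ^ 2) ^ (-(p / 2))
      ≤ ((|m| / ℓ) ^ 2) ^ (-(p / 2)) :=
        Real.rpow_le_rpow_of_nonpos (by positivity) h1 (by linarith)
    _ = (|m| / ℓ) ^ (-p) := by
        rw [← Real.rpow_natCast, ← Real.rpow_mul hq.le]
        congr 1
        push_cast
        ring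
    _ = ℓ ^ p * |m| ^ (-p) := by
        rw [Real.div_rpow (abs_nonneg _) hℓ.le, Real.rpow_neg hℓ.le, div_inv_eq_mul, mul_comm]

theorem spectralDim_gasketDirac_le :
    spectralDim gasketDirac ≤ ENNReal.ofReal (Real.log 3 / (Real.log 5 - Real.log 3)) := by
  rw [spectralDim_gasketDirac]
  refine ENNReal.le_of_forall_pos_le_add fun ε hε _ => ?_
  have hpos := critical_exponent_pos
  set p : ℝ := Real.log 3 / (Real.log 5 - Real.log 3) + ε with hp
  have hε' : (0 : ℝ) < ε := hε
  have hp0 : 0 < p := by positivity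
  have hp1 : 1 < p := by
    have h : 1 < Real.log 3 / (Real.log 5 - Real.log 3) := by
      rw [lt_div_iff₀ log_five_sub_log_three_pos, one_mul, sub_lt_iff_lt_add,
        ← Real.log_mul (by norm_num) (by norm_num)]
      exact Real.log_lt_log (by norm_num) (by norm_num)
    linarith
  have hadd : ENNReal.ofReal (Real.log 3 / (Real.log 5 - Real.log 3)) + ε = ENNReal.ofReal p := by
    rw [hp, ENNReal.ofReal_add hpos.le hε'.le, ENNReal.ofReal_coe_nnreal]
  rw [hadd]
  refine sInf_le ⟨p, hp0, rfl, ?_⟩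
  rw [ENNReal.tsum_sigma']
  have hZ : ∑' k : ℤ, ENNReal.ofReal (|((2 * k + 1 : ℤ) : ℝ)| ^ (-p)) < ⊤ := by
    refine Summable.tsum_ofReal_lt_top ?_
    have hinj : Function.Injective fun k : ℤ => 2 * k + 1 := fun a b h => by
      have h' : 2 * a + 1 = 2 * b + 1 := h
      omega
    exact (Real.summable_abs_int_rpow hp1).comp_injective hinj
  calc ∑' (e : Edge) (k : ℤ), ENNReal.ofReal
        ((1 + (Real.pi * (2 * k + 1) / (2 * (edgeLength e).toReal)) ^ 2) ^ (-(p / 2)))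
      ≤ ∑' (e : Edge) (k : ℤ),
          edgeLength e ^ p * ENNReal.ofReal (|((2 * k + 1 : ℤ) : ℝ)| ^ (-p)) := by
        refine ENNReal.tsum_le_tsum fun e => ENNReal.tsum_le_tsum fun k => ?_
        refine (ENNReal.ofReal_le_ofReal
          (rpow_eigenvalue_le (edgeLength_toReal_pos e) hp0 k)).trans_eq ?_
        rw [ENNReal.ofReal_mul (by positivity), ENNReal.toReal_rpow, ENNReal.ofReal_toReal]
        exact ENNReal.rpow_ne_top_of_nonneg hp0.le (edgeLength_ne_top e)
    _ = (∑' e : Edge, edgeLength e ^ p) *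
          ∑' k : ℤ, ENNReal.ofReal (|((2 * k + 1 : ℤ) : ℝ)| ^ (-p)) := by
        simp_rw [ENNReal.tsum_mul_left, ENNReal.tsum_mul_right]
    _ < ⊤ := ENNReal.mul_lt_top (tsum_edgeLength_rpow_lt_top (by linarith)) hZ

theorem one_le_spectralDim_gasketDirac : 1 ≤ spectralDim gasketDirac := by
  rw [spectralDim_gasketDirac]
  refine le_sInf ?_
  rintro _ ⟨p, hp, rfl, hsum⟩
  rw [ENNReal.one_le_ofReal]
  by_contra! hp1
  set e : Edge := ([], 0)
  set ℓ : ℝ := (edgeLength e).toReal with hℓdef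
  have hℓ : 0 < ℓ := edgeLength_toReal_pos e
  have hinj : Function.Injective fun n : ℕ => (⟨e, (n : ℤ)⟩ : Σ _ : Edge, ℤ) := fun a b h => by
    simpa using h
  have h1 := (ENNReal.tsum_comp_le_tsum_of_injective hinj _).trans_lt hsum
  have h2 := ENNReal.summable_toReal h1.ne
  set A : ℝ := 1 + Real.pi / ℓ with hA
  have hA1 : 1 ≤ A := by
    have : 0 < Real.pi / ℓ := div_pos Real.pi_pos hℓ
    linarith
  have h3 : Summable fun n : ℕ => A⁻¹ * (1 / ((n + 1 : ℕ) : ℝ)) := by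
    refine h2.of_nonneg_of_le (fun n => by positivity) fun n => ?_
    rw [ENNReal.toReal_ofReal (by positivity)]
    have hn : (1 : ℝ) ≤ ((n + 1 : ℕ) : ℝ) := by
      push_cast
      linarith [(Nat.cast_nonneg n : (0 : ℝ) ≤ n)]
    have hAn : 1 ≤ A * ((n + 1 : ℕ) : ℝ) := one_le_mul_of_one_le_of_one_le hA1 hn
    have hx : Real.pi * (2 * ((n : ℤ) : ℝ) + 1) / (2 * ℓ) ≤ Real.pi / ℓ * ((n + 1 : ℕ) : ℝ) := by
      rw [div_mul_eq_mul_div, div_le_div_iff₀ (by positivity) hℓ]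
      push_cast
      nlinarith [mul_pos Real.pi_pos hℓ]
    have hx0 : 0 ≤ Real.pi * (2 * ((n : ℤ) : ℝ) + 1) / (2 * ℓ) := by positivity
    have hle : 1 + (Real.pi * (2 * ((n : ℤ) : ℝ) + 1) / (2 * ℓ)) ^ 2 ≤
        (A * ((n + 1 : ℕ) : ℝ)) ^ 2 := by
      have : 1 + Real.pi * (2 * ((n : ℤ) : ℝ) + 1) / (2 * ℓ) ≤ A * ((n + 1 : ℕ) : ℝ) := by
        rw [hA, add_mul, one_mul]
        linarith
      nlinarith
    calc A⁻¹ * (1 / ((n + 1 : ℕ) : ℝ)) = (A * ((n + 1 : ℕ) : ℝ)) ^ (-1 : ℝ) := by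
          rw [Real.rpow_neg_one, mul_inv, one_div]
      _ ≤ (A * ((n + 1 : ℕ) : ℝ)) ^ (-p) :=
          Real.rpow_le_rpow_of_exponent_le hAn (by linarith)
      _ = ((A * ((n + 1 : ℕ) : ℝ)) ^ 2) ^ (-(p / 2)) := by
          rw [← Real.rpow_natCast _ 2, ← Real.rpow_mul (by positivity)]
          congr 1
          push_cast
          ring
      _ ≤ _ := Real.rpow_le_rpow_of_nonpos (by positivity) hle (by linarith)
  have h4 : Summable fun n : ℕ => 1 / ((n + 1 : ℕ) : ℝ) :=
    (summable_mul_left_iff (inv_ne_zero (by linarith))).1 h3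
  exact Real.not_summable_one_div_natCast
    ((summable_nat_add_iff (f := fun n : ℕ => 1 / (n : ℝ)) 1).1 h4)

end

end HarmonicGasket

theorem mainTheorem5 :
    (∀ s : ℝ, Real.log 3 / (Real.log 5 - Real.log 3) < s →
      ∑' e : HarmonicGasket.Edge, HarmonicGasket.edgeLength e ^ s < ⊤) ∧
    1 ≤ HarmonicGasket.spectralDim HarmonicGasket.gasketDirac ∧
    HarmonicGasket.spectralDim HarmonicGasket.gasketDirac ≤
      ENNReal.ofReal (Real.log 3 / (Real.log 5 - Real.log 3)) :=
  ⟨fun _ hs => HarmonicGasket.tsum_edgeLength_rpow_lt_top hs,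
    HarmonicGasket.one_le_spectralDim_gasketDirac, HarmonicGasket.spectralDim_gasketDirac_le⟩
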